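/- Let $k$ be an algebraically closed field and let $\mathcal A$ be a finite $k$-linear category (a $k$-linear abelian category with finite-dimensional morphism spaces, enough projectives, finitely many simple objects up to isomorphism, and all objects of finite length), equipped with a $k$-bilinear monoidal product $\otimes$ with unit $I$ that is left exact in each variable, a braiding $c$, and a balancing $\theta$, i.e. a natural automorphism of $\mathrm{id}_{\mathcal A}$ with $\theta_I=\mathrm{id}_I$ and $\theta_{X\otimes Y}=c_{Y,X}c_{X,Y}(\theta_X\otimes\theta_Y)$. A ribbon Grothendieck–Verdier structure on $\mathcal A$ is an object $K$ (the dualizing object), an equivalence $D:\mathcal A\to\mathcal A^{\mathrm{op}}$ and isomorphisms $\mathcal A(K,X\otimes Y)\cong\mathcal A(DX,Y)$ natural in $X,Y$, such that $\theta_{DX}=D\theta_X$ for all $X$. Fix one. Put $\kappa(X,Y)=\mathcal A(DX,Y)$, and let $\gamma_{X,Y}:\kappa(I,X\otimes Y)\cong\mathcal A(K,X\otimes Y)\cong\kappa(X,Y)$ be the resulting isomorphism. Define: * $\mathsf{Aut}_\otimes(\mathrm{id}_{\mathcal A})$: the group of monoidal automorphisms of the identity functor; $\mathsf{cAut}_\otimes(\mathrm{id}_{\mathcal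 A})$: the subgroup of those $\lambda$ that preserve the pairing, i.e. $\kappa(\lambda_X,\lambda_Y)=\mathrm{id}_{\kappa(X,Y)}$ for all $X,Y$ (equivalently, $\lambda_{DX}\circ D(\lambda_X)=\mathrm{id}_{DX}$ for all $X$); * $\mathsf{Aut}_{\mathcal A}(I)$: the automorphism group of the object $I$; each $a\in\mathsf{Aut}_{\mathcal A}(I)$ acts on every object $Y\cong Y\otimes I$ by $\mathrm{id}_Y\otimes a$; * $\mathsf{Aut}_{\mathsf fE_2}(\mathcal A)$: the group, under composition, of monoidal isomorphism classes of $k$-linear braided monoidal autoequivalences of $\mathcal A$ that preserve $\theta$; * $\mathsf{cAut}_{\mathsf fE_2}(\mathcal A)$: the group of isomorphism classes of pairs $(F,t)$ of such an autoequivalence $F$ and a natural isomorphism $t:\kappa(X,Y)\cong\kappa(FX,FY)$ compatible with $\gamma$; isomorphisms of pairs are the monoidal natural isomorphisms $e$ that intertwine the isomorphisms $t$ via $\kappa(e,e)$; * $\mathsf{Pic}(Z_2^{\mathsf{bal}}(\mathcal A))$: the group, under $\otimes$, of isomorphism classes of invertible objects of the full subcategory $Z_2^{\mathsf{bal}}(\mathcal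 A)\subset\mathcal A$ of all $X$ with $c_{Y,X}c_{X,Y}=\mathrm{id}$ for all $Y$ and $\theta_X=\mathrm{id}_X$; * $\mathsf{RibGV}(\mathcal A)$: the set of equivalence classes of ribbon Grothendieck–Verdier structures on the balanced braided category $\mathcal A$, pointed by the class of the given one; two structures with pairings $\kappa,\kappa'$ and isomorphisms $\gamma,\gamma'$ are equivalent if there is a $k$-linear braided monoidal autoequivalence $F$ of $\mathcal A$ that preserves $\theta$, together with a natural isomorphism $\kappa(X,Y)\cong\kappa'(FX,FY)$ compatible with $\gamma$ and $\gamma'$. **Theorem.** There is a canonical exact sequence $$1\to\mathsf{cAut}_\otimes(\mathrm{id}_{\mathcal A})\to\mathsf{Aut}_\otimes(\mathrm{id}_{\mathcal A})\xrightarrow{d_2}\mathsf{Aut}_{\mathcal A}(I)\xrightarrow{j}\mathsf{cAut}_{\mathsf fE_2}(\mathcal A)\xrightarrow{q}\mathsf{Aut}_{\mathsf fE_2}(\mathcal A)\xrightarrow{d_1}\mathsf{Pic}(Z_2^{\mathsf{bal}}(\mathcal A))\xrightarrow{p}\mathsf{RibGV}(\mathcal A)\to 1 .$$ Up to and including $q$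 it consists of groups and group homomorphisms; the last stage $d_1,p$ is exact in the sense of pointed sets (all kernels being preimages of base points). Here the first map is the inclusion; $d_2(\lambda)$ is the automorphism of $I$ that acts on $K$ as $\lambda_K$; $j(a)$ is the class of $\mathrm{id}_{\mathcal A}$ with $t:\kappa(X,Y)\to\kappa(X,Y)$ the postcomposition with the action of $a$ on $Y$; $q$ forgets $t$; $d_1[F]=[L]$ where the duality transported along $F$ is $D\otimes L$, i.e. $F(DX)\cong D(FX)\otimes L$ naturally in $X$; and $p[L]$ is the class of the ribbon Grothendieck–Verdier structure with duality $D\otimes L$. Moreover, $d_1$ is a crossed homomorphism: $d_1([F][G])=d_1[F]\otimes F(d_1[G])$. -/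

import Mathlib

open CategoryTheory MonoidalCategory

universe w v u

namespace GV

/-- `A` is a finite `k`-linear category: a linear abelian category with finite-dimensional morphism
spaces, enough projective objects, finitely many simple objects up to isomorphism, and such that
every object has finite length (i.e. is Noetherian and Artinian). -/
class IsFiniteLinear (k : Type w) [Field k] (A : Type u) [Category.{v} A] [Abelian A]
    [Linear k A] : Prop where
  finiteDimensional_hom : ∀ X Y : A, FiniteDimensional k (X ⟶ Y)
  enoughProjectives : EnoughProjectives A
  finite_simples : ∃ (n : ℕ) (S : Fin n → A), ∀ X : A, Simple X → ∃ i, Nonempty (X ≅ S i)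
  finite_length : ∀ X : A, IsNoetherianObject X ∧ IsArtinianObject X

/-- The monoidal product is left exact in each variable. -/
class IsLexMonoidal (A : Type u) [Category.{v} A] [MonoidalCategory A] : Prop where
  lex_left : ∀ X : A, Limits.PreservesFiniteLimits (tensorLeft X)
  lex_right : ∀ X : A, Limits.PreservesFiniteLimits (tensorRight X)

/-- A balancing on a braided monoidal category: a natural automorphism `θ` of the identity functor
with `θ_I = id` and `θ_{X ⊗ Y} = c_{Y,X} c_{X,Y} (θ_X ⊗ θ_Y)`. -/
class BalancedBraided (A : Type u) [Category.{v} A] [MonoidalCategory A]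
    [BraidedCategory A] where
  twist : 𝟭 A ≅ 𝟭 A
  twist_unit : twist.hom.app (𝟙_ A) = 𝟙 (𝟙_ A)
  twist_tensor : ∀ X Y : A, twist.hom.app (X ⊗ Y) =
    (twist.hom.app X ⊗ₘ twist.hom.app Y) ≫ (β_ X Y).hom ≫ (β_ Y X).hom

/-- The component `θ_X : X ⟶ X` of the balancing. -/
def θ {A : Type u} [Category.{v} A] [MonoidalCategory A] [BraidedCategory A]
    [BalancedBraided A] (X : A) : X ⟶ X :=
  (BalancedBraided.twist (A := A)).hom.app X

section Muger

variable (A : Type u) [Category.{v} A] [MonoidalCategory A] [BraidedCategory A]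
  [BalancedBraided A]

/-- The objects of the balanced Müger center: those objects that trivially double braid with every
object and have trivial balancing. -/
def Z2bal : ObjectProperty A := fun X =>
  (∀ Y : A, (β_ X Y).hom ≫ (β_ Y X).hom = 𝟙 (X ⊗ Y)) ∧ θ X = 𝟙 X

instance : (Z2bal A).IsMonoidal where
  prop_unit := by
    refine ⟨fun Y => ?_, BalancedBraided.twist_unit⟩
    simp [braiding_tensorUnit_left, braiding_tensorUnit_right]
  prop_tensor X₁ X₂ h₁ h₂ := by
    refine ⟨fun Y => ?_, ?_⟩
    · rw [BraidedCategory.braiding_tensor_left_hom, BraidedCategory.braiding_tensor_right_hom]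
      simp only [Category.assoc, Iso.hom_inv_id_assoc]
      rw [← comp_whiskerRight_assoc, h₁.1, id_whiskerRight, Category.id_comp,
        Iso.inv_hom_id_assoc, ← whiskerLeft_comp_assoc, h₂.1]
      simp
    · have := BalancedBraided.twist_tensor X₁ X₂
      have e₁ := h₁.2
      have e₂ := h₂.2
      unfold θ at *
      rw [this, e₁, e₂, h₁.1]
      simp

/-- The Picard group of a monoidal category: the group of isomorphism classes of invertible
objects, i.e. the units in the monoid of isomorphism classes of objects under `⊗`. -/
abbrev Pic (C : Type u) [Category.{v} C] [MonoidalCategory C] : Type u := (Skeleton C)ˣ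

variable {A} in
/-- An object of `A` representing a class in the Picard group of the balanced Müger center. -/
noncomputable def Pic.repr (L : Pic (Z2bal A).FullSubcategory) : A :=
  ((fromSkeleton _).obj L.val).obj

end Muger

section Autoequivalences

variable (k : Type w) [Field k] (A : Type u) [Category.{v} A] [Preadditive A] [Linear k A]
  [MonoidalCategory A] [BraidedCategory A] [BalancedBraided A]

/-- The group `Aut_⊗(id_A)` of monoidal natural automorphisms of the identity functor of `A`. -/
def AutTensorId (A : Type u) [Category.{v} A] [MonoidalCategory A] : Subgroup (Aut (𝟭 A)) where
  carrier := {l | NatTrans.IsMonoidal l.hom}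
  one_mem' := inferInstanceAs (NatTrans.IsMonoidal (𝟙 (𝟭 A)))
  mul_mem' {l m} hl hm := by
    have : NatTrans.IsMonoidal l.hom := hl
    have : NatTrans.IsMonoidal m.hom := hm
    exact inferInstanceAs (NatTrans.IsMonoidal (m.hom ≫ l.hom))
  inv_mem' {l} hl := by
    have key : ∀ e : 𝟭 A ≅ 𝟭 A, NatTrans.IsMonoidal e.hom → NatTrans.IsMonoidal e.inv :=
      fun e _ => inferInstance
    exact key l hl

/-- A `k`-linear balanced braided (strong monoidal) endofunctor of `A`. -/
structure BalEnd where
  F : A ⥤ A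
  [braided : F.Braided]
  [additive : F.Additive]
  [linear : F.Linear k]
  map_twist : ∀ X : A, F.map (θ X) = θ (F.obj X)

attribute [instance] BalEnd.braided BalEnd.additive BalEnd.linear

namespace BalEnd

variable {k A}

/-- The identity functor. -/
abbrev id : BalEnd k A where
  F := 𝟭 A
  map_twist _ := rfl

/-- The composite `G ∘ F`. -/
abbrev comp (F G : BalEnd k A) : BalEnd k A where
  F := F.F ⋙ G.F
  map_twist X := by simp [F.map_twist, G.map_twist]

/-- `F` and `G` are isomorphic by a monoidal natural isomorphism. -/
def Equivalent (F G : BalEnd k A) : Prop :=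
  ∃ e : F.F ≅ G.F, NatTrans.IsMonoidal e.hom

instance setoid (k : Type w) [Field k] (A : Type u) [Category.{v} A] [Preadditive A] [Linear k A]
    [MonoidalCategory A] [BraidedCategory A] [BalancedBraided A] : Setoid (BalEnd k A) where
  r := Equivalent
  iseqv :=
    { refl := fun F => ⟨Iso.refl _, inferInstanceAs (NatTrans.IsMonoidal (𝟙 F.F))⟩
      symm := fun ⟨e, _⟩ => ⟨e.symm, inferInstanceAs (NatTrans.IsMonoidal e.inv)⟩
      trans := fun ⟨e, _⟩ ⟨f, _⟩ => ⟨e ≪≫ f, inferInstanceAs (NatTrans.IsMonoidal (e.hom ≫ f.hom))⟩ }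

/-- The monoid of isomorphism classes of balanced braided endofunctors; the product `F * G` is the
class of the composite `F ∘ G` (first `G`, then `F`). -/
instance : Monoid (Quotient (setoid k A)) where
  one := ⟦id⟧
  mul := Quotient.map₂ (fun F G => comp G F) (by
    rintro F F' ⟨e, he⟩ G G' ⟨f, hf⟩
    exact ⟨Functor.isoWhiskerRight f F.F ≪≫ Functor.isoWhiskerLeft G'.F e,
      inferInstanceAs (NatTrans.IsMonoidal
        (Functor.whiskerRight f.hom F.F ≫ Functor.whiskerLeft G'.F e.hom))⟩)
  mul_assoc := by
    rintro ⟨F⟩ ⟨G⟩ ⟨H⟩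
    exact Quotient.sound ⟨(Functor.associator H.F G.F F.F).symm,
      inferInstanceAs (NatTrans.IsMonoidal (Functor.associator H.F G.F F.F).inv)⟩
  one_mul := by
    rintro ⟨F⟩
    exact Quotient.sound ⟨F.F.rightUnitor,
      inferInstanceAs (NatTrans.IsMonoidal F.F.rightUnitor.hom)⟩
  mul_one := by
    rintro ⟨F⟩
    exact Quotient.sound ⟨F.F.leftUnitor,
      inferInstanceAs (NatTrans.IsMonoidal F.F.leftUnitor.hom)⟩

end BalEnd

/-- The group `Aut_{fE₂}(A)` of isomorphism classes of balanced braided autoequivalences of `A`: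
the isomorphism classes of (linear) balanced braided endofunctors that are invertible up to
monoidal isomorphism. -/
abbrev AutfE2 : Type _ := (Quotient (BalEnd.setoid k A))ˣ

end Autoequivalences

section UnitAct

variable {A : Type u} [Category.{v} A] [MonoidalCategory A]

/-- The action of an automorphism `a` of the unit object on an object `Y`, as the automorphism
`Y ≅ Y ⊗ I → Y ⊗ I ≅ Y` given by `id_Y ⊗ a`. -/
def unitAct (Y : A) (a : 𝟙_ A ≅ 𝟙_ A) : Y ≅ Y := (ρ_ Y).symm ≪≫ whiskerLeftIso Y a ≪≫ ρ_ Y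

lemma unitAct_natural {Y Y' : A} (g : Y ⟶ Y') (a : 𝟙_ A ≅ 𝟙_ A) :
    g ≫ (unitAct Y' a).hom = (unitAct Y a).hom ≫ g := by
  simp only [unitAct, Iso.trans_hom, Iso.symm_hom, whiskerLeftIso_hom, Category.assoc]
  rw [rightUnitor_inv_naturality_assoc, ← whisker_exchange_assoc, rightUnitor_naturality]

lemma unitAct_tensor (X Y : A) (a : 𝟙_ A ≅ 𝟙_ A) :
    (unitAct (X ⊗ Y) a).hom = 𝟙 X ⊗ₘ (unitAct Y a).hom := by
  simp [unitAct]

lemma unitAct_refl (Y : A) : (unitAct Y (Iso.refl (𝟙_ A))).hom = 𝟙 Y := by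
  simp [unitAct]

lemma unitAct_trans (Y : A) (a b : 𝟙_ A ≅ 𝟙_ A) :
    (unitAct Y (a ≪≫ b)).hom = (unitAct Y a).hom ≫ (unitAct Y b).hom := by
  simp [unitAct]

end UnitAct

/-- A ribbon Grothendieck–Verdier structure on a balanced braided category `A`: a dualizing object
`K`, a functor `D : A ⥤ Aᵒᵖ` which is an equivalence, isomorphisms `A(K, X ⊗ Y) ≅ A(DX, Y)`
natural in `X` and `Y`, such that `θ_{DX} = D θ_X`. If `⊗` is `k`-bilinear, naturality makes these
isomorphisms and the functor `D` automatically `k`-linear. -/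
structure RibbonGV (k : Type w) [Field k] (A : Type u) [Category.{v} A] [Preadditive A]
    [Linear k A] [MonoidalCategory A] [BraidedCategory A] [BalancedBraided A] where
  K : A
  D : A ⥤ Aᵒᵖ
  isEquivalence : D.IsEquivalence
  rep : ∀ X Y : A, (K ⟶ X ⊗ Y) ≃ ((D.obj X).unop ⟶ Y)
  rep_natural : ∀ {X X' Y Y' : A} (f : X ⟶ X') (g : Y ⟶ Y') (h : K ⟶ X ⊗ Y),
    rep X' Y' (h ≫ (f ⊗ₘ g)) = (D.map f).unop ≫ rep X Y h ≫ g
  ribbon : ∀ X : A, θ (D.obj X).unop = (D.map (θ X)).unop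

section Cyclic

variable {k : Type w} [Field k] {A : Type u} [Category.{v} A] [Preadditive A] [Linear k A]
  [MonoidalCategory A] [BraidedCategory A] [BalancedBraided A]

namespace RibbonGV

variable (R : RibbonGV k A)

/-- The object `DX` of `A`. -/
abbrev dual (X : A) : A := (R.D.obj X).unop

/-- The morphism `Df : DY ⟶ DX` of `A` for `f : X ⟶ Y`. -/
abbrev dualMap {X Y : A} (f : X ⟶ Y) : R.dual Y ⟶ R.dual X := (R.D.map f).unop

/-- The non-degenerate pairing `κ(X, Y) = A(DX, Y)`. -/
abbrev κ (X Y : A) : Type v := R.dual X ⟶ Y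

/-- The functoriality of the pairing `κ` in both variables. -/
def κmap {X X' Y Y' : A} (f : X ⟶ X') (g : Y ⟶ Y') (h : R.κ X Y) : R.κ X' Y' :=
  R.dualMap f ≫ h ≫ g

/-- The structure isomorphism `γ : κ(I, X ⊗ Y) ≅ A(K, I ⊗ (X ⊗ Y)) ≅ A(K, X ⊗ Y) ≅ κ(X, Y)`. -/
def γ (X Y : A) (h : R.κ (𝟙_ A) (X ⊗ Y)) : R.κ X Y :=
  R.rep X Y ((R.rep (𝟙_ A) (X ⊗ Y)).symm h ≫ (λ_ (X ⊗ Y)).hom)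

lemma κmap_id {X Y : A} (h : R.κ X Y) : R.κmap (𝟙 X) (𝟙 Y) h = h := by
  simp only [κmap, dualMap, Category.comp_id]
  rw [R.D.map_id]
  exact Category.id_comp h

lemma κmap_comp {X X' X'' Y Y' Y'' : A} (f : X ⟶ X') (f' : X' ⟶ X'') (g : Y ⟶ Y')
    (g' : Y' ⟶ Y'') (h : R.κ X Y) :
    R.κmap (f ≫ f') (g ≫ g') h = R.κmap f' g' (R.κmap f g h) := by
  simp only [κmap, dualMap, Functor.map_comp, unop_comp, Category.assoc]

lemma γ_natural {X X' Y Y' : A} (f : X ⟶ X') (g : Y ⟶ Y') (h : R.κ (𝟙_ A) (X ⊗ Y)) :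
    R.γ X' Y' (R.κmap (𝟙 _) (f ⊗ₘ g) h) = R.κmap f g (R.γ X Y h) := by
  unfold γ κmap
  rw [← R.rep_natural]
  congr 1
  have := R.rep_natural (𝟙 (𝟙_ A)) (f ⊗ₘ g) ((R.rep _ _).symm h)
  rw [Equiv.apply_symm_apply] at this
  rw [dualMap, ← this, Equiv.symm_apply_apply]
  simp

end RibbonGV

/-- A cyclic balanced braided functor `(A, R) ⟶ (A, S)` between two ribbon Grothendieck–Verdier
categories with the same underlying balanced braided category `A`: a balanced braided functor `F`
with a natural isomorphism `t : κ_R(X, Y) ≅ κ_S(FX, FY)` compatible with the isomorphisms `γ`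
of `R` and `S`. (The symmetry of `κ` is obtained from `γ`, the braiding and the balancing, and is
therefore automatically respected; as `F` is `k`-linear, naturality makes `t` `k`-linear.) -/
structure CyclicFunctor (R S : RibbonGV k A) extends BalEnd k A where
  t : ∀ X Y : A, R.κ X Y ≃ S.κ (F.obj X) (F.obj Y)
  t_natural : ∀ {X X' Y Y' : A} (f : X ⟶ X') (g : Y ⟶ Y') (h : R.κ X Y),
    t X' Y' (R.κmap f g h) = S.κmap (F.map f) (F.map g) (t X Y h)
  t_γ : ∀ (X Y : A) (h : R.κ (𝟙_ A) (X ⊗ Y)),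
    t X Y (R.γ X Y h) =
      S.γ _ _ (S.κmap (Functor.OplaxMonoidal.η F) (Functor.OplaxMonoidal.δ F X Y)
        (t (𝟙_ A) (X ⊗ Y) h))

namespace CyclicFunctor

/-- The identity. -/
def id (R : RibbonGV k A) : CyclicFunctor R R where
  toBalEnd := BalEnd.id
  t _ _ := Equiv.refl _
  t_natural _ _ _ := rfl
  t_γ X Y h := congrArg (R.γ X Y) (R.κmap_id h).symm

/-- The composite `G ∘ F`. -/
def comp {R S T : RibbonGV k A} (F : CyclicFunctor R S) (G : CyclicFunctor S T) :
    CyclicFunctor R T where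
  toBalEnd := F.toBalEnd.comp G.toBalEnd
  t X Y := (F.t X Y).trans (G.t (F.F.obj X) (F.F.obj Y))
  t_natural f g h := by
    simp [F.t_natural, G.t_natural, BalEnd.comp]
  t_γ X Y h := by
    simp only [Equiv.trans_apply, F.t_γ, G.t_γ, G.t_natural, BalEnd.comp]
    rw [← RibbonGV.κmap_comp]
    simp

/-- `F` and `G` are isomorphic as cyclic balanced braided functors: there is a monoidal natural
isomorphism `e : F ≅ G` whose action on the pairing intertwines the cyclic structures. -/
def Equivalent {R S : RibbonGV k A} (F G : CyclicFunctor R S) : Prop :=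
  ∃ e : F.F ≅ G.F, NatTrans.IsMonoidal e.hom ∧
    ∀ (X Y : A) (h : R.κ X Y), G.t X Y h = S.κmap (e.hom.app X) (e.hom.app Y) (F.t X Y h)

lemma Equivalent.refl {R S : RibbonGV k A} (F : CyclicFunctor R S) : Equivalent F F :=
  ⟨Iso.refl _, inferInstanceAs (NatTrans.IsMonoidal (𝟙 F.F)), fun _ _ _ => (S.κmap_id _).symm⟩

lemma Equivalent.symm {R S : RibbonGV k A} {F G : CyclicFunctor R S} (h : Equivalent F G) :
    Equivalent G F := by
  obtain ⟨e, _, he⟩ := h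
  refine ⟨e.symm, inferInstanceAs (NatTrans.IsMonoidal e.inv), fun X Y h => ?_⟩
  rw [he, ← S.κmap_comp]
  simp [S.κmap_id]

lemma Equivalent.trans {R S : RibbonGV k A} {F G H : CyclicFunctor R S} (h : Equivalent F G)
    (h' : Equivalent G H) : Equivalent F H := by
  obtain ⟨e, _, he⟩ := h
  obtain ⟨f, _, hf⟩ := h'
  refine ⟨e ≪≫ f, inferInstanceAs (NatTrans.IsMonoidal (e.hom ≫ f.hom)), fun X Y h => ?_⟩
  rw [hf, he, ← S.κmap_comp]
  rfl

lemma Equivalent.comp {R S T : RibbonGV k A} {F F' : CyclicFunctor R S} {G G' : CyclicFunctor S T}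
    (h : Equivalent F F') (h' : Equivalent G G') : Equivalent (F.comp G) (F'.comp G') := by
  obtain ⟨e, _, he⟩ := h
  obtain ⟨f, _, hf⟩ := h'
  refine ⟨Functor.isoWhiskerRight e G.F ≪≫ Functor.isoWhiskerLeft F'.F f,
    inferInstanceAs (NatTrans.IsMonoidal
        (Functor.whiskerRight e.hom G.F ≫ Functor.whiskerLeft F'.F f.hom)), fun X Y h => ?_⟩
  have h₁ := hf _ _ (F'.t X Y h)
  rw [he, G.t_natural, ← T.κmap_comp, ← he] at h₁
  exact h₁

lemma comp_assoc {R S T U : RibbonGV k A} (F : CyclicFunctor R S) (G : CyclicFunctor S T)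
    (H : CyclicFunctor T U) : Equivalent ((F.comp G).comp H) (F.comp (G.comp H)) :=
  ⟨Functor.associator F.F G.F H.F,
    inferInstanceAs (NatTrans.IsMonoidal (Functor.associator F.F G.F H.F).hom),
    fun _ _ _ => (U.κmap_id _).symm⟩

lemma id_comp {R S : RibbonGV k A} (F : CyclicFunctor R S) : Equivalent ((id R).comp F) F :=
  ⟨F.F.leftUnitor, inferInstanceAs (NatTrans.IsMonoidal F.F.leftUnitor.hom),
    fun _ _ _ => (S.κmap_id _).symm⟩

lemma comp_id {R S : RibbonGV k A} (F : CyclicFunctor R S) : Equivalent (F.comp (id S)) F :=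
  ⟨F.F.rightUnitor, inferInstanceAs (NatTrans.IsMonoidal F.F.rightUnitor.hom),
    fun _ _ _ => (S.κmap_id _).symm⟩

instance setoid (R S : RibbonGV k A) : Setoid (CyclicFunctor R S) where
  r := Equivalent
  iseqv := ⟨Equivalent.refl, Equivalent.symm, Equivalent.trans⟩

/-- The monoid of isomorphism classes of cyclic balanced braided endofunctors; the product `F * G`
is the class of the composite `F ∘ G` (first `G`, then `F`). -/
instance (R : RibbonGV k A) : Monoid (Quotient (setoid R R)) where
  one := ⟦id R⟧
  mul := Quotient.map₂ (fun F G => comp G F) (fun _ _ h _ _ h' => Equivalent.comp h' h)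
  mul_assoc := by
    rintro ⟨F⟩ ⟨G⟩ ⟨H⟩
    exact Quotient.sound (comp_assoc H G F).symm
  one_mul := by
    rintro ⟨F⟩
    exact Quotient.sound (comp_id F)
  mul_one := by
    rintro ⟨F⟩
    exact Quotient.sound (id_comp F)

end CyclicFunctor

/-- The group `cAut_{fE₂}(A)` of isomorphism classes of cyclic balanced braided autoequivalences of
a ribbon Grothendieck–Verdier category `(A, R)`: the isomorphism classes of cyclic balanced braided
endofunctors that are invertible up to cyclic isomorphism. -/
abbrev CAutfE2 (R : RibbonGV k A) : Type _ := (Quotient (CyclicFunctor.setoid R R))ˣ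

/-- The group `cAut_⊗(id_A)` of cyclic monoidal automorphisms of the identity, i.e. of those
monoidal automorphisms `l` of `id_A` that preserve the pairing, `κ(l_X, l_Y) = id`; this says
that `l_{DX}` is the inverse of the morphism `D(l_X) : DX ⟶ DX`. -/
def CAutTensorId (R : RibbonGV k A) : Subgroup (AutTensorId A) where
  carrier := {l | ∀ (X Y : A) (h : R.κ X Y), R.κmap (l.1.hom.app X) (l.1.hom.app Y) h = h}
  one_mem' X Y h := R.κmap_id h
  mul_mem' {l m} hl hm X Y h := by
    have : R.κmap (m.1.hom.app X ≫ l.1.hom.app X) (m.1.hom.app Y ≫ l.1.hom.app Y) h = h := by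
      rw [R.κmap_comp, hm, hl]
    exact this
  inv_mem' {l} hl X Y h := by
    have : R.κmap (l.1.hom.app X ≫ l.1.inv.app X) (l.1.hom.app Y ≫ l.1.inv.app Y) h = h := by
      have key (e : 𝟭 A ≅ 𝟭 A) :
          R.κmap (e.hom.app X ≫ e.inv.app X) (e.hom.app Y ≫ e.inv.app Y) h = h := by
        rw [Iso.hom_inv_id_app, Iso.hom_inv_id_app]
        exact R.κmap_id h
      exact key l.1
    rw [R.κmap_comp, hl] at this
    exact this

/-- Two ribbon Grothendieck–Verdier structures on `A` are equivalent if there is an equivalence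
between them, i.e. a cyclic balanced braided functor that is invertible up to cyclic isomorphism.
The underlying balanced braided functor may be any autoequivalence of `A`. -/
instance RibbonGV.setoid (k : Type w) [Field k] (A : Type u) [Category.{v} A] [Preadditive A]
    [Linear k A] [MonoidalCategory A] [BraidedCategory A] [BalancedBraided A] :
    Setoid (RibbonGV k A) where
  r R S := ∃ (F : CyclicFunctor R S) (G : CyclicFunctor S R),
    (F.comp G).Equivalent (CyclicFunctor.id R) ∧ (G.comp F).Equivalent (CyclicFunctor.id S)
  iseqv :=
    { refl := fun R => ⟨.id R, .id R, CyclicFunctor.id_comp _, CyclicFunctor.id_comp _⟩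
      symm := fun ⟨F, G, h, h'⟩ => ⟨G, F, h', h⟩
      trans := by
        have key : ∀ {R S T : RibbonGV k A} (F : CyclicFunctor R S) (G : CyclicFunctor S R)
            (F' : CyclicFunctor S T) (G' : CyclicFunctor T S),
            (F.comp G).Equivalent (.id R) → (F'.comp G').Equivalent (.id S) →
            ((F.comp F').comp (G'.comp G)).Equivalent (.id R) := by
          intro R S T F G F' G' h h'
          refine (CyclicFunctor.comp_assoc _ _ _).trans (.trans (.comp (.refl F) ?_) h)
          exact (CyclicFunctor.comp_assoc _ _ _).symm.trans
            (.trans (.comp h' (.refl G)) (CyclicFunctor.id_comp G))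
        rintro R S T ⟨F, G, h₁, h₂⟩ ⟨F', G', h₁', h₂'⟩
        exact ⟨F.comp F', G'.comp G, key F G F' G' h₁ h₁', key G' F' G F h₂' h₂⟩ }

/-- The set `RibGV(A)` of equivalence classes of ribbon Grothendieck–Verdier structures on the
balanced braided category `A`. -/
abbrev RibGV (k : Type w) [Field k] (A : Type u) [Category.{v} A] [Preadditive A]
    [Linear k A] [MonoidalCategory A] [BraidedCategory A] [BalancedBraided A] : Type _ :=
  Quotient (RibbonGV.setoid k A)

/-- The homomorphism `cAut_{fE₂}(A) → Aut_{fE₂}(A)` forgetting the cyclic structure. -/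
def forgetCyclic (R : RibbonGV k A) : CAutfE2 R →* AutfE2 k A :=
  Units.map
    { toFun := Quotient.map CyclicFunctor.toBalEnd (fun _ _ ⟨e, he, _⟩ => ⟨e, he⟩)
      map_one' := rfl
      map_mul' := by
        rintro ⟨F⟩ ⟨G⟩
        rfl }

/-- For an automorphism `a` of the unit, the identity functor with the cyclic structure
`κ(X, Y) → κ(X, Y)` given by the action of `a`. -/
def CyclicFunctor.ofUnitAut (R : RibbonGV k A) (a : 𝟙_ A ≅ 𝟙_ A) : CyclicFunctor R R where
  toBalEnd := BalEnd.id
  t X Y := Iso.homCongr (Iso.refl (R.dual X)) (unitAct Y a)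
  t_natural {X X' Y Y'} f g h := by
    have := unitAct_natural g a
    simp [RibbonGV.κmap, this]
  t_γ X Y h := by
    have := R.γ_natural (𝟙 X) (unitAct Y a).hom h
    rw [← unitAct_tensor] at this
    simp only [RibbonGV.κmap, RibbonGV.dualMap, R.D.map_id] at this
    erw [Category.id_comp, Category.id_comp] at this
    have e := R.κmap_id (𝟙 _ ≫ h ≫ (unitAct (X ⊗ Y) a).hom)
    refine (Category.id_comp _).trans (this.symm.trans ?_)
    refine congrArg (R.γ X Y) (Eq.trans ?_ e.symm)
    exact (Category.id_comp _).symm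

lemma CyclicFunctor.ofUnitAut_refl (R : RibbonGV k A) :
    Equivalent (ofUnitAut R (Iso.refl _)) (id R) :=
  ⟨Iso.refl (𝟭 A), inferInstanceAs (NatTrans.IsMonoidal (𝟙 (𝟭 A))), fun X Y h => by
    refine Eq.trans ?_ (R.κmap_id _).symm
    change h = 𝟙 _ ≫ h ≫ (unitAct Y (Iso.refl _)).hom
    rw [unitAct_refl, Category.comp_id, Category.id_comp]⟩

lemma CyclicFunctor.ofUnitAut_trans (R : RibbonGV k A) (a b : 𝟙_ A ≅ 𝟙_ A) :
    Equivalent (ofUnitAut R (a ≪≫ b)) ((ofUnitAut R a).comp (ofUnitAut R b)) :=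
  ⟨(Functor.leftUnitor (𝟭 A)).symm,
    inferInstanceAs (NatTrans.IsMonoidal (Functor.leftUnitor (𝟭 A)).inv), fun X Y h => by
    refine Eq.trans ?_ (R.κmap_id _).symm
    change 𝟙 _ ≫ (𝟙 _ ≫ h ≫ (unitAct Y a).hom) ≫ (unitAct Y b).hom =
      𝟙 _ ≫ h ≫ (unitAct Y (a ≪≫ b)).hom
    simp only [unitAct_trans, Category.id_comp, Category.assoc]⟩

/-- The homomorphism `Aut_A(I) → cAut_{fE₂}(A)` sending `a` to the identity functor with the cyclic
structure given by the action of `a`. -/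
def unitToCyclic (R : RibbonGV k A) : Aut (𝟙_ A) →* CAutfE2 R :=
  MonoidHom.toHomUnits
    { toFun := fun a => ⟦CyclicFunctor.ofUnitAut R a⟧
      map_one' := Quotient.sound (CyclicFunctor.ofUnitAut_refl R)
      map_mul' := fun a b => Quotient.sound (CyclicFunctor.ofUnitAut_trans R b a) }

end Cyclic

end GV

open GV

/-! Everything is controlled by the dualizing object. Let `R`, `S` be ribbon Grothendieck–Verdier
structures and `F` a balanced braided autoequivalence. By Yoneda, a cyclic structure on `F` from `R`
to `S` is the same thing as an isomorphism `u : K_S ≅ F K_R`: compatibility with `γ` reduces the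
pairing isomorphisms to those with first variable `I`, and these are natural maps A(K_R, Y) → A(K_S,
F Y) (`CyclicFunctor.ofIso`, `CyclicFunctor.exists_isInducedBy`). A monoidal isomorphism `e` then
intertwines two cyclic structures `u`, `v` exactly when `u ≫ e_K = v`
(`CyclicFunctor.IsInducedBy.intertwines_iff`).

Two computations remain. First, K ≅ D I and `D` is fully faithful, so every automorphism of `K` is
the action of a unique automorphism of `I` (`RibbonGV.unitAct_bijective`). Second, the dualizing
objects of ribbon structures are, up to isomorphism, the K ⊗ L with `L` invertible in the balanced
Müger center, and K ⊗ L determines `L` (`RibbonGV.tensor`, `RibbonGV.exists_iso_tensor`,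
`RibbonGV.nonempty_iso_of_tensor_iso`). The ribbon condition is what forces `L` into that center.

The sequence can now be read off. A monoidal automorphism `l` of the identity is cyclic iff l_K =
id. The cyclic structure given by `a` is trivial iff some such `l` has l_K equal to the action of
`a`. Cyclic structures on the identity differ by automorphisms of `K`, hence of `I`. An
autoequivalence lifts iff F K ≅ K, and d₁ is defined by F K ≅ K ⊗ L. Finally, `R` and `S` are
equivalent iff K_S ≅ F K_R for some autoequivalence `F`. -/

namespace GV

/-! ### Yoneda arguments relative to an equivalence. -/

section Yoneda

variable {A : Type u} [Category.{v} A]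

/-- A natural family of bijections `(U ⟶ Y) ≃ (V ⟶ G Y)` with `G` essentially surjective is given
by an isomorphism `V ≅ G U`. -/
lemma isIso_of_homEquiv {U V : A} (G : A ⥤ A) [G.EssSurj]
    (φ : ∀ Y, (U ⟶ Y) ≃ (V ⟶ G.obj Y))
    (hφ : ∀ {Y Y' : A} (h : U ⟶ Y) (g : Y ⟶ Y'), φ Y' (h ≫ g) = φ Y h ≫ G.map g)
    [G.Full] [G.Faithful] : IsIso (φ U (𝟙 U)) := by
  have key : ∀ {Y : A} (g : U ⟶ Y), φ Y g = φ U (𝟙 U) ≫ G.map g := fun g => by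
    rw [← hφ, Category.id_comp]
  -- Precomposition with φ(id) must be bijective on maps into every `T`. Replacing `T` by an
  -- isomorphic G Y, it becomes `φ Y` up to the bijection between maps U ⟶ Y and G U ⟶ G Y.
  refine isIso_of_coyoneda_map_bijective _ fun T => ⟨fun f g hfg => ?_, fun f => ?_⟩
  · have hT := G.objObjPreimageIso T
    rw [← cancel_mono hT.inv]
    obtain ⟨f', hf'⟩ := G.map_surjective (f ≫ hT.inv)
    obtain ⟨g', hg'⟩ := G.map_surjective (g ≫ hT.inv)
    rw [← hf', ← hg']
    congr 1
    apply (φ _).injective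
    rw [key f', key g', hf', hg']
    simpa using hfg =≫ hT.inv
  · have hT := G.objObjPreimageIso T
    refine ⟨G.map ((φ _).symm (f ≫ hT.inv)) ≫ hT.hom, ?_⟩
    dsimp only
    rw [← Category.assoc, ← key]
    simp

/-- A natural family of bijections `A(P X, Y) ≃ A(Q X, G Y)` with `G` an equivalence is given by a
natural isomorphism `Q X ≅ G (P X)`. -/
lemma nonempty_iso_of_homEquiv {P Q : A ⥤ Aᵒᵖ} (G : A ⥤ A) [G.IsEquivalence]
    (φ : ∀ X Y, ((P.obj X).unop ⟶ Y) ≃ ((Q.obj X).unop ⟶ G.obj Y))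
    (hφ : ∀ {X X' Y Y' : A} (f : X ⟶ X') (g : Y ⟶ Y') (h : (P.obj X).unop ⟶ Y),
      φ X' Y' ((P.map f).unop ≫ h ≫ g) = (Q.map f).unop ≫ φ X Y h ≫ G.map g) :
    Nonempty (P ⋙ G.op ≅ Q) := by
  have hr : ∀ {X Y Y' : A} (h : (P.obj X).unop ⟶ Y) (g : Y ⟶ Y'),
      φ X Y' (h ≫ g) = φ X Y h ≫ G.map g := fun {X Y Y'} h g => by
    simpa using hφ (𝟙 X) g h
  have hl : ∀ {X X' Y : A} (f : X ⟶ X') (h : (P.obj X).unop ⟶ Y),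
      φ X' Y ((P.map f).unop ≫ h) = (Q.map f).unop ≫ φ X Y h := fun {X X' Y} f h => by
    simpa using hφ f (𝟙 Y) h
  have hiso : ∀ X, IsIso (φ X _ (𝟙 (P.obj X).unop)) := fun X =>
    isIso_of_homEquiv G (φ X) hr
  refine ⟨NatIso.ofComponents (fun X => (asIso (φ X _ (𝟙 (P.obj X).unop))).op) fun {X X'} f => ?_⟩
  apply Quiver.Hom.unop_inj
  change φ X' _ (𝟙 _) ≫ G.map (P.map f).unop = (Q.map f).unop ≫ φ X _ (𝟙 _)
  rw [← hr, ← hl, Category.comp_id, Category.id_comp]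

end Yoneda

-- Since `γ` removes a unit factor by the left unitor, this form of unitality is what moves `γ`
-- through `F`.
open Functor.OplaxMonoidal in
lemma map_leftUnitor_comp_δ {A : Type u} [Category.{v} A] [MonoidalCategory A]
    (F : A ⥤ A) [F.Monoidal] (X Y : A) :
    F.map (λ_ (X ⊗ Y)).hom ≫ δ F X Y =
      δ F (𝟙_ A) (X ⊗ Y) ≫ (η F ⊗ₘ δ F X Y) ≫ (λ_ (F.obj X ⊗ F.obj Y)).hom := by
  rw [MonoidalCategory.tensorHom_def, Category.assoc, leftUnitor_naturality,
    left_unitality_hom_assoc]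

/-! ### Cyclic structures as isomorphisms of dualizing objects. -/

section Cyclic

variable {k : Type w} [Field k] {A : Type u} [Category.{v} A] [Preadditive A] [Linear k A]
  [MonoidalCategory A] [BraidedCategory A] [BalancedBraided A]

lemma RibbonGV.rep_symm_natural (R : RibbonGV k A) {X X' Y Y' : A} (f : X ⟶ X') (g : Y ⟶ Y')
    (h : R.κ X Y) :
    (R.rep X' Y').symm (R.κmap f g h) = (R.rep X Y).symm h ≫ (f ⊗ₘ g) := by
  rw [Equiv.symm_apply_eq, R.rep_natural, Equiv.apply_symm_apply]
  rfl

lemma RibbonGV.κmap_rep (R : RibbonGV k A) {X X' Y Y' : A} (f : X ⟶ X') (g : Y ⟶ Y')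
    (h : R.K ⟶ X ⊗ Y) : R.κmap f g (R.rep X Y h) = R.rep X' Y' (h ≫ (f ⊗ₘ g)) :=
  (R.rep_natural f g h).symm

lemma RibbonGV.γ_rep (R : RibbonGV k A) {X Y : A} (h : R.K ⟶ 𝟙_ A ⊗ (X ⊗ Y)) :
    R.γ X Y (R.rep _ _ h) = R.rep X Y (h ≫ (λ_ (X ⊗ Y)).hom) := by
  simp [RibbonGV.γ]

namespace CyclicFunctor

open Functor.OplaxMonoidal Functor.LaxMonoidal

/-- The pairing isomorphisms of the cyclic functor `C` are those induced by a morphism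
`u : K_S ⟶ C(K_R)` of dualizing objects. -/
def IsInducedBy {R S : RibbonGV k A} (C : CyclicFunctor R S) (u : S.K ⟶ C.F.obj R.K) : Prop :=
  ∀ (X Y : A) (h : R.K ⟶ X ⊗ Y), C.t X Y (R.rep X Y h) = S.rep _ _ (u ≫ C.F.map h ≫ δ C.F X Y)

/-- The cyclic functor with underlying functor `F` induced by an isomorphism of dualizing
objects. -/
noncomputable def ofIso (R S : RibbonGV k A) (F : BalEnd k A) [F.F.Full] [F.F.Faithful]
    (u : S.K ≅ F.F.obj R.K) : CyclicFunctor R S where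
  toBalEnd := F
  t X Y := (R.rep X Y).symm.trans ((Functor.FullyFaithful.ofFullyFaithful F.F).homEquiv.trans
    ((Iso.homCongr u.symm (Functor.Monoidal.μIso F.F X Y).symm).trans (S.rep _ _)))
  t_natural f g h := by
    simp [RibbonGV.rep_symm_natural, RibbonGV.κmap_rep, Functor.FullyFaithful.homEquiv]
  t_γ X Y h := by
    obtain ⟨h, rfl⟩ := (R.rep _ _).surjective h
    simp only [RibbonGV.γ_rep]
    simp only [Functor.FullyFaithful.homEquiv, Equiv.trans_apply, Equiv.symm_apply_apply,
      Equiv.coe_fn_mk, Iso.homCongr_apply, RibbonGV.κmap_rep, RibbonGV.γ_rep]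
    simp [map_leftUnitor_comp_δ]

lemma ofIso_isInducedBy (R S : RibbonGV k A) (F : BalEnd k A) [F.F.Full] [F.F.Faithful]
    (u : S.K ≅ F.F.obj R.K) : (ofIso R S F u).IsInducedBy u.hom := fun X Y h => by
  change S.rep _ _ (u.hom ≫ F.F.map ((R.rep X Y).symm (R.rep X Y h)) ≫ δ F.F X Y) = _
  rw [Equiv.symm_apply_apply]
  rfl

/-- Every cyclic structure on an equivalence is induced by an isomorphism of dualizing objects. -/
lemma exists_isInducedBy {R S : RibbonGV k A} (C : CyclicFunctor R S) [C.F.IsEquivalence] :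
    ∃ u : S.K ≅ C.F.obj R.K, C.IsInducedBy u.hom := by
  -- The chain A(K_R, Y) ≅ κ_R(I, Y) ≅ κ_S(F I, F Y) ≅ A(K_S, F I ⊗ F Y) ≅ A(K_S, F Y); Yoneda then
  -- gives `u` as the image of the identity.
  let φ : ∀ Y, (R.K ⟶ Y) ≃ (S.K ⟶ C.F.obj Y) := fun Y =>
    (Iso.homCongr (Iso.refl _) (λ_ Y).symm).trans <| (R.rep (𝟙_ A) Y).trans <|
      (C.t (𝟙_ A) Y).trans <| (S.rep _ _).symm.trans <| Iso.homCongr (Iso.refl _)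
        (whiskerRightIso (Functor.Monoidal.εIso C.F).symm _ ≪≫ λ_ (C.F.obj Y))
  have φ_apply : ∀ {Y} (h : R.K ⟶ Y), φ Y h =
      (S.rep _ _).symm (C.t (𝟙_ A) Y (R.rep _ _ (h ≫ (λ_ Y).inv))) ≫
        η C.F ▷ _ ≫ (λ_ (C.F.obj Y)).hom := fun h => by simp [φ]
  have hφ : ∀ {Y Y' : A} (h : R.K ⟶ Y) (g : Y ⟶ Y'), φ Y' (h ≫ g) = φ Y h ≫ C.F.map g := by
    intro Y Y' h g
    have h₁ : R.rep (𝟙_ A) Y' ((h ≫ g) ≫ (λ_ Y').inv) =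
        R.κmap (𝟙 _) g (R.rep _ _ (h ≫ (λ_ Y).inv)) := by
      simp [RibbonGV.κmap_rep]
    rw [φ_apply, φ_apply, h₁, C.t_natural, RibbonGV.rep_symm_natural]
    simp
  have : IsIso (φ R.K (𝟙 _)) := isIso_of_homEquiv C.F φ hφ
  refine ⟨asIso (φ R.K (𝟙 _)), fun X Y h => ?_⟩
  have h₂ : C.t (𝟙_ A) (X ⊗ Y) (R.rep _ _ (h ≫ (λ_ _).inv)) =
      S.rep _ _ (φ _ h ≫ (λ_ _).inv ≫ ε C.F ▷ _) := by
    rw [φ_apply]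
    simp
  -- Compatibility with `γ` expresses `t X Y` through `t I (X ⊗ Y)`, which `u` already determines.
  have h₃ := C.t_γ X Y (R.rep _ _ (h ≫ (λ_ _).inv))
  rw [RibbonGV.γ_rep, h₂, RibbonGV.κmap_rep, RibbonGV.γ_rep] at h₃
  simp only [Category.assoc, Iso.inv_hom_id, Category.comp_id] at h₃
  rw [h₃, asIso_hom, ← Category.id_comp h, hφ]
  simp [← map_leftUnitor_comp_δ, ← Functor.map_comp_assoc]

lemma id_isInducedBy (R : RibbonGV k A) : (id R).IsInducedBy (𝟙 R.K) := fun X Y h => by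
  change _ = R.rep X Y (𝟙 _ ≫ h ≫ 𝟙 _)
  rw [Category.id_comp, Category.comp_id]
  rfl

/-- Acting by `a` on the factor `Y` is acting on X ⊗ Y, and by naturality this action slides through
`h` to `K`. -/
lemma ofUnitAut_isInducedBy (R : RibbonGV k A) (a : 𝟙_ A ≅ 𝟙_ A) :
    (ofUnitAut R a).IsInducedBy (unitAct R.K a).hom := fun X Y h => by
  have := R.κmap_rep (𝟙 X) (unitAct Y a).hom h
  rw [← unitAct_tensor, unitAct_natural] at this
  simp only [RibbonGV.κmap, RibbonGV.dualMap, R.D.map_id] at this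
  change 𝟙 _ ≫ R.rep X Y h ≫ (unitAct Y a).hom = R.rep X Y ((unitAct R.K a).hom ≫ h ≫ 𝟙 _)
  rw [Category.comp_id, ← this]
  rfl

lemma IsInducedBy.comp {R S T : RibbonGV k A} {C : CyclicFunctor R S} {C' : CyclicFunctor S T}
    {u : S.K ⟶ C.F.obj R.K} {v : T.K ⟶ C'.F.obj S.K} (hu : C.IsInducedBy u)
    (hv : C'.IsInducedBy v) : (C.comp C').IsInducedBy (v ≫ C'.F.map u) := fun X Y h => by
  refine (congrArg (C'.t _ _) (hu X Y h)).trans ((hv _ _ _).trans ?_)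
  congr 1
  change v ≫ C'.F.map (u ≫ C.F.map h ≫ δ C.F X Y) ≫ δ C'.F _ _ =
    (v ≫ C'.F.map u) ≫ C'.F.map (C.F.map h) ≫ C'.F.map (δ C.F X Y) ≫ δ C'.F _ _
  simp only [Functor.map_comp, Category.assoc]

/-- This turns a condition on all pairings into one equation at the dualizing object. By bijectivity
of `rep`, the condition on `h` is the same equation followed by the image of `h`. -/
lemma IsInducedBy.intertwines_iff {R S : RibbonGV k A} {C C' : CyclicFunctor R S}
    {u : S.K ⟶ C.F.obj R.K} {v : S.K ⟶ C'.F.obj R.K} (hu : C.IsInducedBy u)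
    (hv : C'.IsInducedBy v) (e : C.F ≅ C'.F) [NatTrans.IsMonoidal e.hom] :
    (∀ (X Y : A) (h : R.κ X Y), C'.t X Y h = S.κmap (e.hom.app X) (e.hom.app Y) (C.t X Y h)) ↔
      u ≫ e.hom.app R.K = v := by
  have key : ∀ (X Y : A) (h : R.K ⟶ X ⊗ Y), C'.t X Y (R.rep X Y h) =
      S.κmap (e.hom.app X) (e.hom.app Y) (C.t X Y (R.rep X Y h)) ↔
      v ≫ C'.F.map h = u ≫ e.hom.app R.K ≫ C'.F.map h := fun X Y h => by
    rw [hu, hv, RibbonGV.κmap_rep, Equiv.apply_eq_iff_eq]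
    have h₁ : (u ≫ C.F.map h ≫ δ C.F X Y) ≫ (e.hom.app X ⊗ₘ e.hom.app Y) =
        (u ≫ e.hom.app R.K ≫ C'.F.map h) ≫ δ C'.F X Y := by
      have h₂ : δ C.F X Y ≫ (e.hom.app X ⊗ₘ e.hom.app Y) =
          e.hom.app (X ⊗ Y) ≫ δ C'.F X Y := by
        rw [← cancel_epi (μ C.F X Y), ← cancel_mono (μ C'.F X Y)]
        simp
      simp [h₂]
    rw [h₁, ← Category.assoc, cancel_mono]
  refine ⟨fun H => ?_, fun H X Y h => ?_⟩
  -- For this `h` the image under `C'.F` is invertible and can be cancelled.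
  · have := (key _ _ (λ_ R.K).inv).1 (H _ _ _)
    rw [← Category.assoc, cancel_mono] at this
    exact this.symm
  · obtain ⟨h, rfl⟩ := (R.rep X Y).surjective h
    exact (key X Y h).2 (by rw [← H, Category.assoc])

/-- The pairing isomorphism A(D X, Y) ≅ A(D F X, F Y) represents, by Yoneda, an isomorphism between
D F X and F D X. -/
lemma nonempty_dualIso {R S : RibbonGV k A} (C : CyclicFunctor R S) [C.F.IsEquivalence] :
    Nonempty (R.D ⋙ C.F.op ≅ C.F ⋙ S.D) :=
  nonempty_iso_of_homEquiv (Q := C.F ⋙ S.D) C.F C.t (fun f g h => C.t_natural f g h)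

end CyclicFunctor

lemma BalEnd.isEquivalence_of_equivalent {F G : BalEnd k A}
    (h : (F.comp G).Equivalent id) (h' : (G.comp F).Equivalent id) : F.F.IsEquivalence :=
  let ⟨e, _⟩ := h
  let ⟨e', _⟩ := h'
  (CategoryTheory.Equivalence.mk F.F G.F e.symm e').isEquivalence_functor

lemma AutfE2.exists_inverse (Φ : AutfE2 k A) (F : BalEnd k A) (hF : ⟦F⟧ = Φ.val) :
    ∃ G : BalEnd k A, ⟦G⟧ = Φ⁻¹.val ∧ (F.comp G).Equivalent .id ∧ (G.comp F).Equivalent .id := by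
  obtain ⟨G, hG⟩ := Quotient.exists_rep Φ⁻¹.val
  refine ⟨G, hG, Quotient.exact (s := BalEnd.setoid k A) ?_,
    Quotient.exact (s := BalEnd.setoid k A) ?_⟩
  · have := Φ.inv_mul
    rw [← hF, ← hG] at this
    exact this
  · have := Φ.mul_inv
    rw [← hF, ← hG] at this
    exact this

namespace CyclicFunctor

lemma exists_comp_equivalent_id {R S : RibbonGV k A} (C : CyclicFunctor R S) (G : BalEnd k A)
    [C.F.IsEquivalence] [G.F.IsEquivalence] (h : (C.toBalEnd.comp G).Equivalent .id) :
    ∃ C' : CyclicFunctor S R, C'.toBalEnd = G ∧ (C.comp C').Equivalent (id R) := by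
  obtain ⟨u, hu⟩ := C.exists_isInducedBy
  obtain ⟨e, he⟩ := h
  -- Forced by the requirement that `v ≫ G(u)`, the isomorphism inducing the composite, followed by
  -- `e_K` be the identity.
  let v : R.K ≅ G.F.obj S.K := (e.app R.K).symm ≪≫ G.F.mapIso u.symm
  refine ⟨ofIso S R G v, rfl, e, he, ?_⟩
  have : NatTrans.IsMonoidal (F₁ := (C.comp (ofIso S R G v)).F) (F₂ := (id R).F) e.hom := he
  refine ((hu.comp (ofIso_isInducedBy S R G v)).intertwines_iff (id_isInducedBy R) e).2 ?_
  change (((e.app R.K).inv ≫ G.F.map u.inv) ≫ G.F.map u.hom) ≫ (e.app R.K).hom = 𝟙 _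
  rw [Category.assoc (e.app R.K).inv, ← G.F.map_comp, u.inv_hom_id, G.F.map_id]
  exact (congrArg (· ≫ _) (Category.comp_id _)).trans (Iso.inv_hom_id _)

/-- The two given isomorphisms need not be compatible with each other, so the inverse built from the
first is not directly two-sided. Since `C'` has in turn an inverse `C''` on its other side, the
usual monoid argument identifies `C''` with `C`. -/
lemma exists_inverse {R S : RibbonGV k A} (C : CyclicFunctor R S) (G : BalEnd k A)
    (h : (C.toBalEnd.comp G).Equivalent .id) (h' : (G.comp C.toBalEnd).Equivalent .id) :
    ∃ C' : CyclicFunctor S R, C'.toBalEnd = G ∧ (C.comp C').Equivalent (id R) ∧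
      (C'.comp C).Equivalent (id S) := by
  have := BalEnd.isEquivalence_of_equivalent h h'
  have := BalEnd.isEquivalence_of_equivalent h' h
  obtain ⟨C', rfl, h₁⟩ := C.exists_comp_equivalent_id G h
  obtain ⟨C'', -, h₂⟩ := C'.exists_comp_equivalent_id C.toBalEnd h'
  refine ⟨C', rfl, h₁, .trans (.comp (.refl C') ?_) h₂⟩
  exact (comp_id C).symm.trans <| (Equivalent.comp (.refl C) h₂.symm).trans <|
    (comp_assoc C C' C'').symm.trans <| (Equivalent.comp h₁ (.refl C'')).trans (id_comp C'')

end CyclicFunctor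

/-- Together with `RibbonGV.exists_iso_of_equiv`, this reduces equivalence of structures to
dualizing objects. -/
lemma RibbonGV.equiv_of_iso (R S : RibbonGV k A) (Φ : AutfE2 k A) (F : BalEnd k A)
    (hF : ⟦F⟧ = Φ.val) (u : S.K ≅ F.F.obj R.K) : R ≈ S := by
  obtain ⟨G, -, h, h'⟩ := Φ.exists_inverse F hF
  have := BalEnd.isEquivalence_of_equivalent h h'
  obtain ⟨C, -, hC⟩ := (CyclicFunctor.ofIso R S F u).exists_inverse G h h'
  exact ⟨_, C, hC⟩

lemma CyclicFunctor.Equivalent.toBalEnd {R S : RibbonGV k A} {C C' : CyclicFunctor R S}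
    (h : C.Equivalent C') : C.toBalEnd.Equivalent C'.toBalEnd :=
  let ⟨e, he, _⟩ := h
  ⟨e, he⟩

lemma RibbonGV.exists_iso_of_equiv {R S : RibbonGV k A} (h : R ≈ S) :
    ∃ (Φ : AutfE2 k A) (F : BalEnd k A), ⟦F⟧ = Φ.val ∧ Nonempty (S.K ≅ F.F.obj R.K) := by
  obtain ⟨C, C', h, h'⟩ := h
  have := BalEnd.isEquivalence_of_equivalent h.toBalEnd h'.toBalEnd
  obtain ⟨u, -⟩ := C.exists_isInducedBy
  exact ⟨⟨⟦C.toBalEnd⟧, ⟦C'.toBalEnd⟧, Quotient.sound h'.toBalEnd, Quotient.sound h.toBalEnd⟩,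
    C.toBalEnd, rfl, ⟨u⟩⟩

end Cyclic

/-! ### Unit action, balanced Müger center and invertible objects. -/

section Balanced

variable {A : Type u} [Category.{v} A] [MonoidalCategory A] [BraidedCategory A]

/-- The action is defined from the right, where it is visibly that on the last factor; the braiding
transfers this to the first factor. -/
lemma unitAct_whiskerRight (X Y : A) (a : 𝟙_ A ≅ 𝟙_ A) :
    (unitAct X a).hom ▷ Y = (unitAct (X ⊗ Y) a).hom := by
  rw [← cancel_mono (β_ X Y).hom, ← unitAct_natural, unitAct_tensor, id_tensorHom,
    BraidedCategory.braiding_naturality_left]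

omit [BraidedCategory A] in
lemma unitAct_unit (a : 𝟙_ A ≅ 𝟙_ A) : (unitAct (𝟙_ A) a).hom = a.hom := by
  simp [unitAct, ← unitors_equal, ← unitors_inv_equal]

variable [BalancedBraided A]

lemma θ_naturality {X Y : A} (f : X ⟶ Y) : f ≫ θ Y = θ X ≫ f :=
  (BalancedBraided.twist (A := A)).hom.naturality f

instance (X : A) : IsIso (θ X) :=
  inferInstanceAs (IsIso ((BalancedBraided.twist (A := A)).hom.app X))

lemma Z2bal.θ_tensor_left {L : A} (hL : Z2bal A L) (X : A) : θ (L ⊗ X) = L ◁ θ X := by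
  have : θ (L ⊗ X) = (θ L ⊗ₘ θ X) ≫ (β_ L X).hom ≫ (β_ X L).hom :=
    BalancedBraided.twist_tensor L X
  rw [this, hL.1, hL.2, id_tensorHom, Category.comp_id]

lemma Z2bal.θ_tensor_right {L : A} (hL : Z2bal A L) (X : A) : θ (X ⊗ L) = θ X ▷ L := by
  rw [← cancel_epi (β_ L X).hom, θ_naturality, hL.θ_tensor_left,
    BraidedCategory.braiding_naturality_right]

/-- Taking X = I gives θ_L = id; the balancing formula then leaves only the double braiding, because
θ_Y is invertible. In this form membership can be tested against the ribbon condition. -/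
lemma Z2bal_of_θ_tensor {L : A} (hL : ∀ X, θ (L ⊗ X) = L ◁ θ X) : Z2bal A L := by
  have hθ : θ L = 𝟙 L := by
    have h₁ := hL (𝟙_ A)
    have h₂ : θ (𝟙_ A) = 𝟙 _ := BalancedBraided.twist_unit
    have h₃ := θ_naturality (ρ_ L).hom
    rw [h₁, h₂, MonoidalCategory.whiskerLeft_id, Category.id_comp] at h₃
    rw [← cancel_epi (ρ_ L).hom, h₃, Category.comp_id]
  refine ⟨fun Y => ?_, hθ⟩
  have h : θ (L ⊗ Y) = (θ L ⊗ₘ θ Y) ≫ (β_ L Y).hom ≫ (β_ Y L).hom :=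
    BalancedBraided.twist_tensor L Y
  rw [hL, hθ, id_tensorHom] at h
  rw [← cancel_epi (L ◁ θ Y), ← h, Category.comp_id]

lemma θ_tensor_of_iso_unit {N : A} (e : N ≅ 𝟙_ A) (X : A) : θ (N ⊗ X) = N ◁ θ X := by
  rw [← cancel_mono (e.hom ▷ X ≫ (λ_ X).hom), ← θ_naturality]
  simp [whisker_exchange_assoc]

/-- After tensoring with `L`, the criterion for `L'` becomes the one for L ⊗ L' ≅ I. -/
lemma Z2bal.of_inverse {L L' : A} [(tensorLeft L).Faithful] (hL : Z2bal A L)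
    (e : L ⊗ L' ≅ 𝟙_ A) : Z2bal A L' := by
  refine Z2bal_of_θ_tensor fun X => (tensorLeft L).map_injective ?_
  change L ◁ θ (L' ⊗ X) = L ◁ L' ◁ θ X
  rw [← hL.θ_tensor_left, ← cancel_epi (α_ L L' X).hom, θ_naturality, θ_tensor_of_iso_unit e]
  simp

variable {L L' : A}

/-- Tensoring with an invertible object is an equivalence. -/
def tensorRightEquivalence (e : L ⊗ L' ≅ 𝟙_ A) : A ≌ A :=
  CategoryTheory.Equivalence.mk (tensorRight L) (tensorRight L')
    (NatIso.ofComponents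
      (fun X => (ρ_ X).symm ≪≫ whiskerLeftIso X e.symm ≪≫ (α_ X L L').symm)
      (fun {X Y} f => by
        change f ≫ (ρ_ Y).inv ≫ Y ◁ e.inv ≫ (α_ Y L L').inv =
          ((ρ_ X).inv ≫ X ◁ e.inv ≫ (α_ X L L').inv) ≫ f ▷ L ▷ L'
        rw [rightUnitor_inv_naturality_assoc, ← whisker_exchange_assoc,
          associator_inv_naturality_left]
        simp))
    (NatIso.ofComponents
      -- Only L ⊗ L' ≅ I is given; the braiding supplies the inverse on the other side.
      (fun X => α_ X L' L ≪≫ whiskerLeftIso X (β_ L' L ≪≫ e) ≪≫ ρ_ X)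
      (fun {X Y} f => by
        change f ▷ L' ▷ L ≫ (α_ Y L' L).hom ≫ Y ◁ ((β_ L' L).hom ≫ e.hom) ≫ (ρ_ Y).hom =
          ((α_ X L' L).hom ≫ X ◁ ((β_ L' L).hom ≫ e.hom) ≫ (ρ_ X).hom) ≫ f
        rw [associator_naturality_left_assoc, ← whisker_exchange_assoc, rightUnitor_naturality]
        simp))

/-- The bijection `A(W ⊗ L, Z) ≃ A(W, Z ⊗ L')` for inverse objects `L` and `L'`. -/
def tensorRightHomEquiv (e : L ⊗ L' ≅ 𝟙_ A) (W Z : A) : (W ⊗ L ⟶ Z) ≃ (W ⟶ Z ⊗ L') :=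
  (tensorRightEquivalence e).toAdjunction.homEquiv W Z

omit [BalancedBraided A] in
lemma tensorRightHomEquiv_natural (e : L ⊗ L' ≅ 𝟙_ A) {W W' Z Z' : A} (p : W' ⟶ W)
    (f : W ⊗ L ⟶ Z) (q : Z ⟶ Z') :
    tensorRightHomEquiv e W' Z' (p ▷ L ≫ f ≫ q) = p ≫ tensorRightHomEquiv e W Z f ≫ q ▷ L' := by
  refine ((tensorRightEquivalence e).toAdjunction.homEquiv_naturality_left p (f ≫ q)).trans ?_
  exact congrArg (p ≫ ·) ((tensorRightEquivalence e).toAdjunction.homEquiv_naturality_right f q)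

omit [BalancedBraided A] in
lemma tensorRightHomEquiv_symm_natural (e : L ⊗ L' ≅ 𝟙_ A) {W W' Z Z' : A} (p : W' ⟶ W)
    (f : W ⟶ Z ⊗ L') (q : Z ⟶ Z') :
    (tensorRightHomEquiv e W' Z').symm (p ≫ f ≫ q ▷ L') =
      p ▷ L ≫ (tensorRightHomEquiv e W Z).symm f ≫ q := by
  rw [Equiv.symm_apply_eq, tensorRightHomEquiv_natural, Equiv.apply_symm_apply]

end Balanced

/-! ### Ribbon Grothendieck–Verdier structures and invertible objects. -/

section Cyclic

variable {k : Type w} [Field k] {A : Type u} [Category.{v} A] [Preadditive A] [Linear k A]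
  [MonoidalCategory A] [BraidedCategory A] [BalancedBraided A]

namespace RibbonGV

lemma dualMap_unitAct (R : RibbonGV k A) (X : A) (a : 𝟙_ A ≅ 𝟙_ A) :
    R.dualMap (unitAct X a).hom = (unitAct (R.dual X) a).hom := by
  -- `h` is the copairing K ⟶ X ⊗ DX; acting by `a` on either factor has the same effect on it.
  obtain ⟨h, hh⟩ := (R.rep X (R.dual X)).surjective (𝟙 _)
  have h₁ := R.rep_natural (unitAct X a).hom (𝟙 (R.dual X)) h
  have h₂ := R.rep_natural (𝟙 X) (unitAct (R.dual X) a).hom h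
  rw [tensorHom_id, unitAct_whiskerRight, unitAct_tensor, h₂, hh] at h₁
  simpa using h₁.symm

/-- The dualizing object is the dual of the unit. -/
lemma nonempty_iso_dual_unit (R : RibbonGV k A) : Nonempty (R.K ≅ R.dual (𝟙_ A)) := by
  let φ : ∀ Y, (R.dual (𝟙_ A) ⟶ Y) ≃ (R.K ⟶ Y) := fun Y =>
    (R.rep _ Y).symm.trans (Iso.homCongr (Iso.refl _) (λ_ Y))
  have := isIso_of_homEquiv (𝟭 A) φ fun h g => by
    have := R.rep_symm_natural (𝟙 (𝟙_ A)) g h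
    simp only [RibbonGV.κmap, RibbonGV.dualMap, R.D.map_id, unop_id, Category.id_comp] at this
    simp [φ, this]
  exact ⟨asIso (φ _ (𝟙 _))⟩

/-- The automorphisms of the dualizing object are given by the action of those of the unit. -/
lemma unitAct_bijective (R : RibbonGV k A) :
    Function.Bijective (unitAct R.K : (𝟙_ A ≅ 𝟙_ A) → (R.K ≅ R.K)) := by
  obtain ⟨i⟩ := R.nonempty_iso_dual_unit
  have := R.isEquivalence
  -- Under K ≅ D I the action of `a` on `K` becomes D(a).
  have key : ∀ a : 𝟙_ A ≅ 𝟙_ A, i.inv ≫ (unitAct R.K a).hom ≫ i.hom = R.dualMap a.hom :=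
    fun a => by
      rw [← unitAct_natural, Iso.inv_hom_id_assoc, ← dualMap_unitAct, unitAct_unit]
  refine ⟨fun a b hab => ?_, fun f => ?_⟩
  · have h : R.dualMap a.hom = R.dualMap b.hom := by rw [← key, hab, key]
    exact Iso.ext (R.D.map_injective (Quiver.Hom.unop_inj h))
  · refine ⟨R.D.preimageIso (i.symm ≪≫ f ≪≫ i).op, Iso.ext ?_⟩
    rw [← cancel_epi i.inv, ← cancel_mono i.hom, Category.assoc, key]
    simp [RibbonGV.dualMap]

/-- The ribbon Grothendieck–Verdier structure with dualizing object `K ⊗ L` and duality `D ⊗ L`,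
for an invertible object `L` of the balanced Müger center. -/
def tensor (R : RibbonGV k A) {L L' : A} (e : L ⊗ L' ≅ 𝟙_ A) (hL : Z2bal A L) :
    RibbonGV k A where
  K := R.K ⊗ L
  D := R.D ⋙ (tensorRight L).op
  isEquivalence := by
    have := R.isEquivalence
    have : (tensorRight L).IsEquivalence := (tensorRightEquivalence e).isEquivalence_functor
    infer_instance
  -- A(K ⊗ L, X ⊗ Y) ≅ A(K, X ⊗ (Y ⊗ L')) ≅ A(DX, Y ⊗ L') ≅ A(DX ⊗ L, Y).
  rep X Y := (tensorRightHomEquiv e R.K (X ⊗ Y)).trans <|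
    (Iso.homCongr (Iso.refl _) (α_ X Y L')).trans <| (R.rep X (Y ⊗ L')).trans
      (tensorRightHomEquiv e _ Y).symm
  rep_natural {X X' Y Y'} f g h := by
    have h₁ := tensorRightHomEquiv_natural e (𝟙 R.K) h (f ⊗ₘ g)
    simp only [id_whiskerRight, Category.id_comp] at h₁
    have h₂ := R.rep_natural f (g ▷ L') (tensorRightHomEquiv e _ _ h ≫ (α_ X Y L').hom)
    have h₃ := tensorRightHomEquiv_symm_natural e (R.dualMap f)
      (R.rep _ _ (tensorRightHomEquiv e _ _ h ≫ (α_ X Y L').hom)) g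
    rw [← h₂] at h₃
    simp only [Equiv.trans_apply, Iso.homCongr_apply, Iso.refl_inv, Category.id_comp, h₁]
    refine Eq.trans ?_ h₃
    simp only [Category.assoc, ← tensorHom_id, associator_naturality]
  ribbon X := by
    refine (hL.θ_tensor_right _).trans ?_
    rw [R.ribbon]
    rfl

/-- The dual of an inverse of `L` is `K ⊗ L`. -/
lemma nonempty_tensor_iso_dual (R : RibbonGV k A) {L L' : A} (e : L ⊗ L' ≅ 𝟙_ A) :
    Nonempty (R.K ⊗ L ≅ R.dual L') := by
  let φ : ∀ Y, (R.dual L' ⟶ Y) ≃ (R.K ⊗ L ⟶ Y) := fun Y =>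
    (R.rep L' Y).symm.trans <| (Iso.homCongr (Iso.refl _) (β_ L' Y)).trans
      (tensorRightHomEquiv e _ Y).symm
  have := isIso_of_homEquiv (𝟭 A) φ fun {Y Y'} h g => by
    have h₁ := R.rep_symm_natural (𝟙 L') g h
    simp only [RibbonGV.κmap, RibbonGV.dualMap, R.D.map_id, unop_id, Category.id_comp] at h₁
    have h₂ := tensorRightHomEquiv_symm_natural e (𝟙 R.K) ((R.rep L' Y).symm h ≫ (β_ L' Y).hom) g
    simp only [id_whiskerRight, Category.id_comp, Category.assoc] at h₂
    simp [φ, h₁, h₂]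
  exact ⟨asIso (φ _ (𝟙 _))⟩

/-- An invertible object `L` is determined by `K ⊗ L`. -/
lemma nonempty_iso_of_tensor_iso (R : RibbonGV k A) {L L' M M' : A} (e : L ⊗ L' ≅ 𝟙_ A)
    (e' : M ⊗ M' ≅ 𝟙_ A) (f : R.K ⊗ L ≅ R.K ⊗ M) : Nonempty (L ≅ M) := by
  obtain ⟨i⟩ := R.nonempty_tensor_iso_dual e
  obtain ⟨j⟩ := R.nonempty_tensor_iso_dual e'
  have := R.isEquivalence
  -- K ⊗ L and K ⊗ M are the duals of L' and M', and `D` reflects isomorphisms between them;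
  -- inverses of isomorphic objects are isomorphic.
  let g : M' ≅ L' := R.D.preimageIso (i.symm ≪≫ f ≪≫ j).op
  exact ⟨(ρ_ L).symm ≪≫ whiskerLeftIso L (e'.symm ≪≫ β_ M M' ≪≫ whiskerRightIso g M) ≪≫
    (α_ L L' M).symm ≪≫ whiskerRightIso e M ≪≫ λ_ M⟩

/-- Any two ribbon Grothendieck–Verdier structures differ by an invertible object of the balanced
Müger center. -/
lemma exists_iso_tensor (R S : RibbonGV k A) : ∃ L L' : A, Z2bal A L ∧ Z2bal A L' ∧
    Nonempty (L ⊗ L' ≅ 𝟙_ A) ∧ Nonempty (S.K ≅ R.K ⊗ L) := by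
  have := R.isEquivalence
  have := S.isEquivalence
  let M := R.D.objPreimage (Opposite.op S.K)
  let i : S.K ≅ R.dual M := (R.D.objObjPreimageIso (Opposite.op S.K)).unop
  -- With K_S ≅ D_R M, this represents D_S X ≅ D_R(M ⊗ X); hence M ⊗ – is an equivalence and `M` is
  -- invertible.
  let φ : ∀ X Y, (S.dual X ⟶ Y) ≃ (R.dual (M ⊗ X) ⟶ Y) := fun X Y =>
    (S.rep X Y).symm.trans <| (Iso.homCongr i (Iso.refl _)).trans <| (R.rep M (X ⊗ Y)).symm.trans <|
      (Iso.homCongr (Iso.refl _) (α_ M X Y).symm).trans (R.rep (M ⊗ X) Y)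
  obtain ⟨w⟩ := nonempty_iso_of_homEquiv (P := S.D) (Q := tensorLeft M ⋙ R.D) (𝟭 A) φ
    fun {X X' Y Y'} f g h => by
      have h₁ := S.rep_symm_natural f g h
      have h₂ := R.rep_symm_natural (𝟙 M) (f ⊗ₘ g) (i.inv ≫ (S.rep X Y).symm h)
      have h₃ := R.rep_natural (M ◁ f) g
        ((R.rep M (X ⊗ Y)).symm (i.inv ≫ (S.rep X Y).symm h) ≫ (α_ M X Y).inv)
      simp only [RibbonGV.κmap, RibbonGV.dualMap, R.D.map_id, unop_id, Category.id_comp,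
        Category.assoc] at h₁ h₂ h₃
      simp only [φ, Equiv.trans_apply, Iso.homCongr_apply, Iso.refl_inv, Iso.refl_hom,
        Category.id_comp, Category.comp_id, h₁, h₂, Iso.symm_hom, Functor.id_map]
      refine Eq.trans ?_ h₃
      congr 1
      simp only [Category.assoc, ← id_tensorHom, associator_inv_naturality]
  have : (tensorLeft M ⋙ R.D).IsEquivalence := Functor.isEquivalence_of_iso w
  have : (tensorLeft M).IsEquivalence := Functor.isEquivalence_of_comp_right _ R.D
  let M' := (tensorLeft M).objPreimage (𝟙_ A)
  let e : M ⊗ M' ≅ 𝟙_ A := (tensorLeft M).objObjPreimageIso (𝟙_ A)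
  -- Both structures are ribbon, so naturality of `θ` along D_S X ≅ D_R(M ⊗ X) identifies the images
  -- under D_R of θ_{M ⊗ X} and M ◁ θ_X.
  have hM : Z2bal A M := Z2bal_of_θ_tensor fun X => by
    refine R.D.map_injective (Quiver.Hom.unop_inj ?_)
    have h := congrArg Quiver.Hom.unop (w.hom.naturality (θ X))
    change (w.hom.app X).unop ≫ (S.D.map (θ X)).unop =
      (R.D.map (M ◁ θ X)).unop ≫ (w.hom.app X).unop at h
    rw [← S.ribbon] at h
    rw [← R.ribbon, ← cancel_mono (w.hom.app X).unop, ← h]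
    exact (θ_naturality (w.hom.app X).unop).symm
  obtain ⟨j⟩ := R.nonempty_tensor_iso_dual (β_ M' M ≪≫ e)
  exact ⟨M', M, hM.of_inverse e, hM, ⟨β_ M' M ≪≫ e⟩, ⟨i ≪≫ j.symm⟩⟩

/-- The transport of a ribbon Grothendieck–Verdier structure along a balanced braided
autoequivalence. -/
noncomputable def transport (R : RibbonGV k A) (F : BalEnd k A) [F.F.IsEquivalence] :
    RibbonGV k A where
  K := F.F.obj R.K
  D := F.F.inv ⋙ R.D ⋙ F.F.op
  isEquivalence := by
    have := R.isEquivalence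
    infer_instance
  rep X Y := (Iso.homCongr (Iso.refl _)
    (((F.F.asEquivalence.counitIso.app X).symm ⊗ᵢ (F.F.asEquivalence.counitIso.app Y).symm) ≪≫
      Functor.Monoidal.μIso F.F (F.F.inv.obj X) (F.F.inv.obj Y))).trans <|
    (Functor.FullyFaithful.ofFullyFaithful F.F).homEquiv.symm.trans <|
    (R.rep (F.F.inv.obj X) (F.F.inv.obj Y)).trans <|
    (Functor.FullyFaithful.ofFullyFaithful F.F).homEquiv.trans <|
    Iso.homCongr (Iso.refl _) (F.F.asEquivalence.counitIso.app Y)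
  rep_natural {X X' Y Y'} f g h := by
    let ε (X : A) : F.F.obj (F.F.inv.obj X) ≅ X := F.F.asEquivalence.counitIso.app X
    have hε : ∀ {X Y : A} (f : X ⟶ Y), f ≫ (ε Y).inv = (ε X).inv ≫ F.F.map (F.F.inv.map f) :=
      fun f => F.F.asEquivalence.counitIso.inv.naturality f
    have hε' : ∀ {X Y : A} (f : X ⟶ Y), F.F.map (F.F.inv.map f) ≫ (ε Y).hom = (ε X).hom ≫ f :=
      fun f => F.F.asEquivalence.counitIso.hom.naturality f
    let z : ∀ {X Y : A}, (F.F.obj R.K ⟶ X ⊗ Y) → (R.K ⟶ F.F.inv.obj X ⊗ F.F.inv.obj Y) :=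
      fun {X Y} h => F.F.preimage (𝟙 _ ≫ h ≫ ((ε X).inv ⊗ₘ (ε Y).inv) ≫ Functor.LaxMonoidal.μ F.F _ _)
    have hz : z (h ≫ (f ⊗ₘ g)) = z h ≫ (F.F.inv.map f ⊗ₘ F.F.inv.map g) := by
      apply F.F.map_injective
      simp only [z, Functor.map_comp, Functor.map_preimage, Category.id_comp, Category.assoc]
      rw [tensorHom_comp_tensorHom_assoc, hε, hε, ← tensorHom_comp_tensorHom_assoc,
        Functor.LaxMonoidal.μ_natural]
    change 𝟙 _ ≫ F.F.map (R.rep _ _ (z (h ≫ (f ⊗ₘ g)))) ≫ (ε Y').hom =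
      F.F.map (R.dualMap (F.F.inv.map f)) ≫
        (𝟙 _ ≫ F.F.map (R.rep _ _ (z h)) ≫ (ε Y).hom) ≫ g
    rw [hz, R.rep_natural]
    simp only [Functor.map_comp, Category.assoc, Category.id_comp, hε']
  ribbon X := by
    -- The quasi-inverse preserves the balancing because `F` does and is faithful.
    have h : θ (F.F.inv.obj X) = F.F.inv.map (θ X) := by
      apply F.F.map_injective
      rw [F.map_twist]
      let ε : F.F.obj (F.F.inv.obj X) ≅ X := F.F.asEquivalence.counitIso.app X
      have hε : F.F.map (F.F.inv.map (θ X)) ≫ ε.hom = ε.hom ≫ θ X :=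
        F.F.asEquivalence.counitIso.hom.naturality (θ X)
      rw [← cancel_mono ε.hom, hε, θ_naturality]
    change θ (F.F.obj (R.dual (F.F.inv.obj X))) = F.F.map (R.dualMap (F.F.inv.map (θ X)))
    rw [← F.map_twist, R.ribbon, h]

end RibbonGV

end Cyclic

/-! ### Representatives of classes in the Picard group. -/

namespace Pic

variable {A : Type u} [Category.{v} A] [MonoidalCategory A] [BraidedCategory A]
  [BalancedBraided A]

lemma Z2bal_repr (L : Pic (Z2bal A).FullSubcategory) : Z2bal A L.repr :=
  ((fromSkeleton _).obj L.val).property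

lemma nonempty_repr_tensor_inv (L : Pic (Z2bal A).FullSubcategory) :
    Nonempty (L.repr ⊗ L⁻¹.repr ≅ 𝟙_ A) := by
  have h := L.mul_inv
  rw [Skeleton.mul_eq, Skeleton.one_eq, toSkeleton_eq_toSkeleton_iff] at h
  obtain ⟨i⟩ := h
  exact ⟨(Z2bal A).ι.mapIso i⟩

lemma eq_of_repr_iso {L M : Pic (Z2bal A).FullSubcategory} (i : L.repr ≅ M.repr) : L = M := by
  refine Units.ext ?_
  rw [← toSkeleton_fromSkeleton_obj L.val, ← toSkeleton_fromSkeleton_obj M.val,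
    toSkeleton_eq_toSkeleton_iff]
  exact ⟨(Z2bal A).ι.preimageIso i⟩

lemma nonempty_repr_one : Nonempty ((1 : Pic (Z2bal A).FullSubcategory).repr ≅ 𝟙_ A) :=
  ⟨(Z2bal A).ι.mapIso (fromSkeletonToSkeletonIso (𝟙_ (Z2bal A).FullSubcategory))⟩

lemma exists_repr_iso {L L' : A} (hL : Z2bal A L) (hL' : Z2bal A L') (e : L ⊗ L' ≅ 𝟙_ A) :
    ∃ P : Pic (Z2bal A).FullSubcategory, Nonempty (P.repr ≅ L) := by
  let X : (Z2bal A).FullSubcategory := ⟨L, hL⟩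
  let Y : (Z2bal A).FullSubcategory := ⟨L', hL'⟩
  have h₁ : Nonempty (X ⊗ Y ≅ 𝟙_ _) := ⟨(Z2bal A).ι.preimageIso e⟩
  have h₂ : Nonempty (Y ⊗ X ≅ 𝟙_ _) := ⟨(Z2bal A).ι.preimageIso (β_ L' L ≪≫ e)⟩
  rw [← toSkeleton_eq_toSkeleton_iff, Skeleton.toSkeleton_tensorObj, ← Skeleton.one_eq] at h₁ h₂
  exact ⟨⟨toSkeleton X, toSkeleton Y, h₁, h₂⟩,
    ⟨(Z2bal A).ι.mapIso (fromSkeletonToSkeletonIso X)⟩⟩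

end Pic

/-! ### The maps of the sequence and exactness. -/

section Cyclic

variable {k : Type w} [Field k] {A : Type u} [Category.{v} A] [Preadditive A] [Linear k A]
  [MonoidalCategory A] [BraidedCategory A] [BalancedBraided A] (R : RibbonGV k A)

/-- The ribbon Grothendieck–Verdier structure `K ⊗ L` for a class `L` in the Picard group of the
balanced Müger center. -/
noncomputable def RibbonGV.tensorPic (L : Pic (Z2bal A).FullSubcategory) : RibbonGV k A :=
  R.tensor (Classical.choice L.nonempty_repr_tensor_inv) L.Z2bal_repr

lemma RibbonGV.exists_iso_tensorPic (S : RibbonGV k A) :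
    ∃ L : Pic (Z2bal A).FullSubcategory, Nonempty (S.K ≅ R.K ⊗ L.repr) := by
  obtain ⟨L, L', hL, hL', ⟨e⟩, ⟨i⟩⟩ := R.exists_iso_tensor S
  obtain ⟨P, ⟨j⟩⟩ := Pic.exists_repr_iso hL hL' e
  exact ⟨P, ⟨i ≪≫ whiskerLeftIso R.K j.symm⟩⟩

lemma RibbonGV.pic_eq_of_tensor_iso {L M : Pic (Z2bal A).FullSubcategory}
    (i : R.K ⊗ L.repr ≅ R.K ⊗ M.repr) : L = M := by
  obtain ⟨e⟩ := L.nonempty_repr_tensor_inv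
  obtain ⟨e'⟩ := M.nonempty_repr_tensor_inv
  obtain ⟨j⟩ := R.nonempty_iso_of_tensor_iso e e' i
  exact Pic.eq_of_repr_iso j

lemma AutfE2.isEquivalence (Φ : AutfE2 k A) (F : BalEnd k A) (hF : ⟦F⟧ = Φ.val) :
    F.F.IsEquivalence := by
  obtain ⟨G, -, h, h'⟩ := Φ.exists_inverse F hF
  exact BalEnd.isEquivalence_of_equivalent h h'

/-- F K is the dualizing object of the transported structure, so it has the form K ⊗ L. -/
lemma AutfE2.exists_pic (Φ : AutfE2 k A) : ∃ L : Pic (Z2bal A).FullSubcategory,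
    ∀ F : BalEnd k A, ⟦F⟧ = Φ.val → Nonempty (F.F.obj R.K ≅ R.K ⊗ L.repr) := by
  obtain ⟨F, hF⟩ := Quotient.exists_rep Φ.val
  have := Φ.isEquivalence F hF
  obtain ⟨L, ⟨i⟩⟩ := R.exists_iso_tensorPic (R.transport F)
  refine ⟨L, fun G hG => ?_⟩
  obtain ⟨e, -⟩ : G.Equivalent F := Quotient.exact (s := BalEnd.setoid k A) (hG.trans hF.symm)
  exact ⟨e.app R.K ≪≫ i⟩

/-- The class `L` with `F(K) ≅ K ⊗ L`. -/
noncomputable def AutfE2.pic (Φ : AutfE2 k A) : Pic (Z2bal A).FullSubcategory :=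
  (Φ.exists_pic R).choose

lemma AutfE2.nonempty_obj_iso (Φ : AutfE2 k A) (F : BalEnd k A) (hF : ⟦F⟧ = Φ.val) :
    Nonempty (F.F.obj R.K ≅ R.K ⊗ (Φ.pic R).repr) :=
  (Φ.exists_pic R).choose_spec F hF

lemma AutfE2.pic_eq_iff (Φ : AutfE2 k A) (F : BalEnd k A) (hF : ⟦F⟧ = Φ.val)
    (L : Pic (Z2bal A).FullSubcategory) :
    Φ.pic R = L ↔ Nonempty (F.F.obj R.K ≅ R.K ⊗ L.repr) := by
  obtain ⟨i⟩ := Φ.nonempty_obj_iso R F hF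
  refine ⟨fun h => h ▸ ⟨i⟩, fun ⟨j⟩ => R.pic_eq_of_tensor_iso (i.symm ≪≫ j)⟩

/-- F K ≅ K ⊗ L makes `F` a cyclic functor to the structure with duality D ⊗ L, and cyclic functors
commute with dualities. -/
lemma AutfE2.nonempty_dualIso (Φ : AutfE2 k A) (F : BalEnd k A) (hF : ⟦F⟧ = Φ.val) :
    Nonempty (R.D ⋙ F.F.op ≅ F.F ⋙ R.D ⋙ (tensorRight (Φ.pic R).repr).op) := by
  have := Φ.isEquivalence F hF
  obtain ⟨i⟩ := Φ.nonempty_obj_iso R F hF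
  let C := CyclicFunctor.ofIso R (R.tensorPic (Φ.pic R)) F i.symm
  have : C.F.IsEquivalence := ‹F.F.IsEquivalence›
  exact C.nonempty_dualIso

/-- Cancel `K` in F G K ≅ F(K ⊗ L_Ψ) ≅ F K ⊗ F L_Ψ ≅ K ⊗ (L_Φ ⊗ F L_Ψ). -/
lemma AutfE2.nonempty_pic_mul_iso (Φ Ψ : AutfE2 k A) (F : BalEnd k A) (hF : ⟦F⟧ = Φ.val) :
    Nonempty (((Φ * Ψ).pic R).repr ≅ (Φ.pic R).repr ⊗ F.F.obj (Ψ.pic R).repr) := by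
  obtain ⟨G, hG⟩ := Quotient.exists_rep Ψ.val
  obtain ⟨i⟩ := Φ.nonempty_obj_iso R F hF
  obtain ⟨j⟩ := Ψ.nonempty_obj_iso R G hG
  obtain ⟨l⟩ := (Φ * Ψ).nonempty_obj_iso R (G.comp F) (by
    rw [Units.val_mul, ← hF, ← hG]
    rfl)
  obtain ⟨a⟩ := (Φ.pic R).nonempty_repr_tensor_inv
  obtain ⟨b⟩ := (Ψ.pic R).nonempty_repr_tensor_inv
  obtain ⟨c⟩ := ((Φ * Ψ).pic R).nonempty_repr_tensor_inv
  let b' : F.F.obj (Ψ.pic R).repr ⊗ F.F.obj (Ψ.pic R)⁻¹.repr ≅ 𝟙_ A :=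
    Functor.Monoidal.μIso F.F _ _ ≪≫ F.F.mapIso b ≪≫ (Functor.Monoidal.εIso F.F).symm
  let d : ((Φ.pic R).repr ⊗ F.F.obj (Ψ.pic R).repr) ⊗
      (F.F.obj (Ψ.pic R)⁻¹.repr ⊗ (Φ.pic R)⁻¹.repr) ≅ 𝟙_ A :=
    α_ _ _ _ ≪≫ whiskerLeftIso _ ((α_ _ _ _).symm ≪≫ whiskerRightIso b' _ ≪≫ λ_ _) ≪≫ a
  exact R.nonempty_iso_of_tensor_iso c d (l.symm ≪≫ F.F.mapIso j ≪≫
    (Functor.Monoidal.μIso F.F _ _).symm ≪≫ whiskerRightIso i _ ≪≫ α_ _ _ _)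

/-- The automorphism of the unit that acts on the dualizing object as `f`. -/
noncomputable def RibbonGV.unitOfAut (f : R.K ≅ R.K) : 𝟙_ A ≅ 𝟙_ A :=
  (R.unitAct_bijective.2 f).choose

lemma RibbonGV.unitAct_unitOfAut (f : R.K ≅ R.K) : unitAct R.K (R.unitOfAut f) = f :=
  (R.unitAct_bijective.2 f).choose_spec

/-- The homomorphism `Aut_⊗(id_A) → Aut_A(I)` sending `l` to the automorphism of the unit acting on
the dualizing object `K` as `l_K`. -/
noncomputable def unitOfTensorId : AutTensorId A →* Aut (𝟙_ A) where
  toFun l := R.unitOfAut (l.1.app R.K)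
  map_one' := by
    refine R.unitAct_bijective.1 ((R.unitAct_unitOfAut _).trans (Iso.ext ?_))
    exact (unitAct_refl R.K).symm
  map_mul' l m := by
    refine R.unitAct_bijective.1 ((R.unitAct_unitOfAut _).trans (Iso.ext ?_))
    refine Eq.trans ?_ (unitAct_trans R.K _ _).symm
    rw [R.unitAct_unitOfAut, R.unitAct_unitOfAut]
    rfl

lemma unitAct_unitOfTensorId (l : AutTensorId A) :
    (unitAct R.K (unitOfTensorId R l)).hom = l.1.hom.app R.K :=
  congrArg Iso.hom (R.unitAct_unitOfAut (l.1.app R.K))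

lemma unitOfTensorId_eq_iff (l : AutTensorId A) (a : Aut (𝟙_ A)) :
    unitOfTensorId R l = a ↔ l.1.hom.app R.K = (unitAct R.K a).hom := by
  rw [← unitAct_unitOfTensorId]
  exact ⟨fun h => by rw [h], fun h => R.unitAct_bijective.1 (Iso.ext h)⟩

lemma mem_CAutTensorId_iff (l : AutTensorId A) :
    l ∈ CAutTensorId R ↔ l.1.hom.app R.K = 𝟙 R.K := by
  have hl : NatTrans.IsMonoidal (F₁ := (CyclicFunctor.id R).F) (F₂ := (CyclicFunctor.id R).F)
    l.1.hom := l.2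
  have h := (CyclicFunctor.id_isInducedBy R).intertwines_iff (CyclicFunctor.id_isInducedBy R) l.1
  rw [← Category.id_comp (l.1.hom.app R.K)]
  exact Iff.trans ⟨fun h X Y f => (h X Y f).symm, fun h X Y f => (h X Y f).symm⟩ h

lemma range_CAutTensorId_subtype :
    (CAutTensorId R).subtype.range = (unitOfTensorId R).ker := by
  ext l
  rw [Subgroup.range_subtype, mem_CAutTensorId_iff, MonoidHom.mem_ker, unitOfTensorId_eq_iff]
  rw [show (unitAct R.K (1 : Aut (𝟙_ A))).hom = 𝟙 _ from unitAct_refl R.K]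

lemma range_unitOfTensorId : (unitOfTensorId R).range = (unitToCyclic R).ker := by
  ext a
  have h : a ∈ (unitToCyclic R).ker ↔
      (CyclicFunctor.id R).Equivalent (CyclicFunctor.ofUnitAut R a) := by
    rw [MonoidHom.mem_ker, Units.ext_iff, eq_comm]
    exact Quotient.eq (r := CyclicFunctor.setoid R R)
  rw [h]
  constructor
  · rintro ⟨l, hl⟩
    have : NatTrans.IsMonoidal (F₁ := (CyclicFunctor.id R).F)
      (F₂ := (CyclicFunctor.ofUnitAut R a).F) l.1.hom := l.2
    refine ⟨l.1, l.2, ((CyclicFunctor.id_isInducedBy R).intertwines_iff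
      (CyclicFunctor.ofUnitAut_isInducedBy R a) l.1).2 ?_⟩
    exact (Category.id_comp _).trans ((unitOfTensorId_eq_iff R l a).1 hl)
  · rintro ⟨e, he, he'⟩
    refine ⟨⟨e, he⟩, (unitOfTensorId_eq_iff R _ a).2 ?_⟩
    exact (Category.id_comp _).symm.trans (((CyclicFunctor.id_isInducedBy R).intertwines_iff
      (CyclicFunctor.ofUnitAut_isInducedBy R a) e).1 he')

lemma forgetCyclic_val (Ψ : CAutfE2 R) (C : CyclicFunctor R R) (hC : ⟦C⟧ = Ψ.val) :
    (forgetCyclic R Ψ).val = ⟦C.toBalEnd⟧ := by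
  obtain ⟨_, _, _, _⟩ := Ψ
  subst hC
  rfl

lemma range_unitToCyclic : (unitToCyclic R).range = (forgetCyclic R).ker := by
  ext Ψ
  constructor
  · rintro ⟨a, rfl⟩
    exact Units.ext rfl
  · intro h
    obtain ⟨C, hC⟩ := Quotient.exists_rep Ψ.val
    have h₁ := congrArg Units.val (MonoidHom.mem_ker.1 h)
    rw [forgetCyclic_val R Ψ C hC] at h₁
    obtain ⟨e, he⟩ : C.toBalEnd.Equivalent .id := Quotient.exact (s := BalEnd.setoid k A) h₁
    have : C.F.IsEquivalence := Functor.isEquivalence_of_iso e.symm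
    obtain ⟨u, hu⟩ := C.exists_isInducedBy
    -- Transporting the cyclic structure of `C` to the identity along `e` gives this automorphism of
    -- `K`, which is the action of some `a`.
    obtain ⟨a, ha⟩ := R.unitAct_bijective.2 (u ≪≫ e.app R.K)
    refine ⟨a, Units.ext (Eq.trans ?_ hC)⟩
    have : NatTrans.IsMonoidal (F₁ := C.F) (F₂ := (CyclicFunctor.ofUnitAut R a).F) e.hom := he
    refine Quotient.sound (CyclicFunctor.Equivalent.symm ⟨e, he, ?_⟩)
    refine (hu.intertwines_iff (CyclicFunctor.ofUnitAut_isInducedBy R a) e).2 ?_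
    rw [ha]
    rfl

/-- A lift of `F` is an isomorphism K ≅ F K; invertibility of the lift is then automatic by
`CyclicFunctor.exists_inverse`. -/
lemma mem_range_forgetCyclic_iff (Φ : AutfE2 k A) (F : BalEnd k A) (hF : ⟦F⟧ = Φ.val) :
    Φ ∈ (forgetCyclic R).range ↔ Nonempty (R.K ≅ F.F.obj R.K) := by
  constructor
  · rintro ⟨Ψ, rfl⟩
    obtain ⟨C, hC⟩ := Quotient.exists_rep Ψ.val
    have h := forgetCyclic_val R Ψ C hC
    have := (forgetCyclic R Ψ).isEquivalence C.toBalEnd h.symm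
    obtain ⟨u, -⟩ := C.exists_isInducedBy
    obtain ⟨e, -⟩ : C.toBalEnd.Equivalent F :=
      Quotient.exact (s := BalEnd.setoid k A) (h.symm.trans hF.symm)
    exact ⟨u ≪≫ e.app R.K⟩
  · rintro ⟨u⟩
    have := Φ.isEquivalence F hF
    obtain ⟨G, -, h, h'⟩ := Φ.exists_inverse F hF
    obtain ⟨C, -, hC, hC'⟩ := (CyclicFunctor.ofIso R R F u).exists_inverse G h h'
    exact ⟨⟨⟦CyclicFunctor.ofIso R R F u⟧, ⟦C⟧, Quotient.sound hC', Quotient.sound hC⟩,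
      Units.ext hF⟩

lemma mem_range_forgetCyclic_iff_pic (Φ : AutfE2 k A) :
    Φ ∈ (forgetCyclic R).range ↔ Φ.pic R = 1 := by
  obtain ⟨F, hF⟩ := Quotient.exists_rep Φ.val
  obtain ⟨e⟩ := Pic.nonempty_repr_one (A := A)
  rw [mem_range_forgetCyclic_iff R Φ F hF, Φ.pic_eq_iff R F hF]
  let i := whiskerLeftIso R.K e ≪≫ ρ_ R.K
  exact ⟨fun ⟨u⟩ => ⟨u.symm ≪≫ i.symm⟩, fun ⟨u⟩ => ⟨i.symm ≪≫ u.symm⟩⟩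

lemma RibbonGV.equiv_of_K_iso {R S : RibbonGV k A} (u : S.K ≅ R.K) : R ≈ S :=
  RibbonGV.equiv_of_iso R S 1 .id rfl u

lemma mem_range_pic_iff (L : Pic (Z2bal A).FullSubcategory) :
    L ∈ Set.range (AutfE2.pic R) ↔ (⟦R.tensorPic L⟧ : RibGV k A) = ⟦R⟧ := by
  rw [eq_comm, Quotient.eq]
  constructor
  · rintro ⟨Φ, rfl⟩
    obtain ⟨F, hF⟩ := Quotient.exists_rep Φ.val
    obtain ⟨i⟩ := Φ.nonempty_obj_iso R F hF
    exact R.equiv_of_iso _ Φ F hF i.symm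
  · intro h
    obtain ⟨Φ, F, hF, ⟨u⟩⟩ := RibbonGV.exists_iso_of_equiv h
    exact ⟨Φ, (Φ.pic_eq_iff R F hF L).2 ⟨u.symm⟩⟩

lemma tensorPic_one : (⟦R.tensorPic 1⟧ : RibGV k A) = ⟦R⟧ := by
  obtain ⟨e⟩ := Pic.nonempty_repr_one (A := A)
  exact Quotient.sound (RibbonGV.equiv_of_K_iso ((ρ_ R.K).symm ≪≫ whiskerLeftIso R.K e.symm))

lemma tensorPic_surjective :
    Function.Surjective fun L => (⟦R.tensorPic L⟧ : RibGV k A) := by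
  intro S
  obtain ⟨S, rfl⟩ := Quotient.exists_rep S
  obtain ⟨L, ⟨i⟩⟩ := R.exists_iso_tensorPic S
  exact ⟨L, Quotient.sound (RibbonGV.equiv_of_K_iso i)⟩

end Cyclic

end GV

theorem theorem4p1 {k : Type w} [Field k] [IsAlgClosed k]
    {A : Type u} [Category.{v} A] [Abelian A] [Linear k A] [IsFiniteLinear k A]
    [MonoidalCategory A] [MonoidalPreadditive A] [MonoidalLinear k A] [IsLexMonoidal A]
    [BraidedCategory A] [BalancedBraided A] (R : RibbonGV k A) :
    ∃ (d₂ : AutTensorId A →* Aut (𝟙_ A))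
      (d₁ : AutfE2 k A → Pic (Z2bal A).FullSubcategory)
      (p : Pic (Z2bal A).FullSubcategory → RibGV k A),
      -- description of the maps: `d₂ l` acts on `K` as `l_K`; the duality of `A` transported along
      -- `F` is `D ⊗ L` with `L` representing `d₁ [F]`, i.e. `F (D X) ≅ D (F X) ⊗ L` naturally;
      -- `p [L]` is the class of the ribbon Grothendieck–Verdier structure with duality `D ⊗ L`
      (∀ l : AutTensorId A, (unitAct R.K (d₂ l)).hom = l.1.hom.app R.K) ∧
      (∀ (Φ : AutfE2 k A) (F : BalEnd k A), ⟦F⟧ = Φ.val →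
        Nonempty (R.D ⋙ F.F.op ≅ F.F ⋙ R.D ⋙ (tensorRight (d₁ Φ).repr).op)) ∧
      (∀ L : Pic (Z2bal A).FullSubcategory, ∃ S : RibbonGV k A,
        Nonempty (S.D ≅ R.D ⋙ (tensorRight L.repr).op) ∧ p L = ⟦S⟧) ∧
      -- `d₁ (Φ Ψ) = d₁ Φ ⊗ Φ (d₁ Ψ)`, and `p` preserves the base points
      (∀ (Φ Ψ : AutfE2 k A) (F : BalEnd k A), ⟦F⟧ = Φ.val →
        Nonempty ((d₁ (Φ * Ψ)).repr ≅ (d₁ Φ).repr ⊗ F.F.obj (d₁ Ψ).repr)) ∧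
      p 1 = ⟦R⟧ ∧
      -- exactness
      Function.Injective (CAutTensorId R).subtype ∧
      (CAutTensorId R).subtype.range = d₂.ker ∧
      d₂.range = (unitToCyclic R).ker ∧
      (unitToCyclic R).range = (forgetCyclic R).ker ∧
      (∀ Φ : AutfE2 k A, Φ ∈ (forgetCyclic R).range ↔ d₁ Φ = 1) ∧
      (∀ L : Pic (Z2bal A).FullSubcategory, L ∈ Set.range d₁ ↔ p L = ⟦R⟧) ∧
      Function.Surjective p := by
  exact ⟨unitOfTensorId R, AutfE2.pic R, fun L => ⟦R.tensorPic L⟧, unitAct_unitOfTensorId R,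
    AutfE2.nonempty_dualIso R, fun L => ⟨R.tensorPic L, ⟨Iso.refl _⟩, rfl⟩,
    AutfE2.nonempty_pic_mul_iso R, tensorPic_one R, Subtype.val_injective,
    range_CAutTensorId_subtype R, range_unitOfTensorId R, range_unitToCyclic R,
    mem_range_forgetCyclic_iff_pic R, mem_range_pic_iff R, tensorPic_surjective R⟩
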